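/- Let $d\ge 1$ be an integer and let $2\le p<\infty$. Let $B_d$ be the open unit ball of $\mathbb{C}^d$, $\partial B_d$ the unit sphere and $\sigma_d$ the normalized Lebesgue measure on $\partial B_d$. For a holomorphic function $f$ on $B_d$ put \[ \mathcal{R}f(z)=\sum_{j=1}^d z_j\frac{\partial f}{\partial z_j}(z),\quad z\in B_d, \qquad M_p(f,r)=\Bigl(\int_{\partial B_d}|f(r\zeta)|^p\,d\sigma_d(\zeta)\Bigr)^{1/p},\quad 0<r<1. \] Given a gauge function $\omega:(0,1]\to(0,+\infty)$, the weighted Hardy--Bloch space $\mathcal{B}^\omega_p(B_d)$ consists of the holomorphic functions $f$ on $B_d$ such that \[ \|f\|_{\mathcal{B}^\omega_p(B_d)}=|f(0)|+\sup_{0<r<1}\frac{M_p(\mathcal{R}f,r)\,(1-r)}{\omega(1-r)}<\infty . \] Put \[ \Phi_\omega(x)=1+\int_x^1\frac{\omega^2(t)}{t}\,dt\in[1,+\infty],\quad 0<x<1 \] (a lower Lebesgue integral if $\omega$ is not measurable). Then for every gauge function $\omega$ there is a constant $C>0$, depending only on $d$, $p$ and $\omega$, such that \[ M_p(f,r)\le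 C\,\|f\|_{\mathcal{B}^\omega_p(B_d)}\,\Phi_\omega^{1/2}(1-r),\quad 0<r<1, \] for all $f\in\mathcal{B}^\omega_p(B_d)$. Moreover, for increasing (that is, nondecreasing) gauge functions $\omega$ the constant $C$ can be chosen to depend only on $d$ and $p$. -/

import Mathlib

open MeasureTheory Set
open scoped ENNReal NNReal

noncomputable section

namespace HardyBloch

/-- The space `ℂ^d` with its Hermitian norm. -/
abbrev Cn (d : ℕ) : Type := EuclideanSpace ℂ (Fin d)

/-- The surface measure on the unit sphere of `ℂ^d = ℝ^{2d}`. -/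
def surface (d : ℕ) : Measure (Metric.sphere (0 : Cn d) 1) :=
  (volume : Measure (Cn d)).toSphere

/-- The normalized Lebesgue measure `σ_d` on the unit sphere of `ℂ^d`. -/
def sigma (d : ℕ) : Measure (Metric.sphere (0 : Cn d) 1) :=
  (surface d univ)⁻¹ • surface d

/-- Holomorphic functions on the open unit ball of `ℂ^d`
(only the values of `f` on the ball matter). -/
def IsHol {d : ℕ} (f : Cn d → ℂ) : Prop :=
  DifferentiableOn ℂ f (Metric.ball 0 1)

/-- The radial derivative `Rf(z) = ∑ z_j ∂f/∂z_j (z)`. -/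
def radial {d : ℕ} (f : Cn d → ℂ) (z : Cn d) : ℂ :=
  ∑ j : Fin d, z j * fderiv ℂ f z (EuclideanSpace.single j 1)

/-- The integral mean `M_p(f, r) = (∫ |f(rζ)|^p dσ_d(ζ))^{1/p}`, with values in `[0, ∞]`. -/
def mean {d : ℕ} (p : ℝ) (f : Cn d → ℂ) (r : ℝ) : ℝ≥0∞ :=
  (∫⁻ ζ : Metric.sphere (0 : Cn d) 1,
    ENNReal.ofReal ‖f ((r : ℂ) • (ζ : Cn d))‖ ^ p ∂(sigma d)) ^ (1 / p)

/-- A gauge function `ω : (0, 1] → (0, ∞)` (only the values on `(0, 1]` matter). -/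
def IsGauge (ω : ℝ → ℝ) : Prop := ∀ t ∈ Ioc (0 : ℝ) 1, 0 < ω t

/-- `|f(0)| + sup_{0<r<1} M_p(Rf, r) (1 - r) / ω(1 - r)`, with values in `[0, ∞]`. -/
def hbNorm {d : ℕ} (ω : ℝ → ℝ) (p : ℝ) (f : Cn d → ℂ) : ℝ≥0∞ :=
  ENNReal.ofReal ‖f 0‖ +
    ⨆ r ∈ Ioo (0 : ℝ) 1,
      mean p (radial f) r * ENNReal.ofReal (1 - r) / ENNReal.ofReal (ω (1 - r))

/-- Membership in the weighted Hardy–Bloch space. -/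
def MemHB {d : ℕ} (ω : ℝ → ℝ) (p : ℝ) (f : Cn d → ℂ) : Prop :=
  IsHol f ∧ hbNorm ω p f < ∞

/-- `Φ_ω(x) = 1 + ∫_x^1 ω(t)^2 / t dt`, with values in `[1, ∞]`. -/
def Phi (ω : ℝ → ℝ) (x : ℝ) : ℝ≥0∞ :=
  1 + ∫⁻ t in Ioo x 1, ENNReal.ofReal (ω t ^ 2 / t)

end HardyBloch

end

/-! The proof is a Littlewood–Paley argument resting on a Hardy–Stein formula. For a function
holomorphic on slices, the Laplacian of `(|f|² + ε)^{p/2}` in logarithmic coordinates is `p` times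
`lapl` evaluated at `f` and `Rf`; here `ε > 0` removes the singularities at zeros of `f`. Averaging
over the sphere kills the rotational part, because `σ_d` is invariant under unimodular scalars. So
`G(t) = regMean p ε f t` satisfies `(t d/dt)² G = p · laplMean`, and two integrations give `G(r) =
G(0) + ∫₀^r log(r/t) p · laplMean dt/t`. As `p ≥ 2`, Hölder's inequality bounds `p · laplMean` by
`p² G(t)^{1-2/p} M_p(Rf,t)²`, and `G` is increasing. Dividing by `G(r)^{1-2/p}` and letting `ε → 0`
yields `mean_sq_le`: `M_p(f,r)² ≤ |f(0)|² + p² ∫₀^r log(r/t) M_p(Rf,t)² dt/t`. It remains to insert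
`M_p(Rf,t) ≤ ‖f‖ ω(1-t)/(1-t)`. For `t ≥ 1/4` the kernel is at most `16(1-t)`, which produces the
integral in `Phi`. Near `t = 0` the kernel is singular and `ω` near `1` is uncontrolled; there
`Rf(0) = 0` and a Schwarz lemma on slices (`mean_le_of_map_zero`) leave only the quantity `r
ω(1/2)²`. It is at most `ω(1/2)² Φ` in general, and at most `2Φ` when `ω` is increasing. -/

noncomputable section

namespace HardyBloch

open Filter Topology ComplexConjugate

/-! ### Slice holomorphic functions and their radial derivative -/

section SliceHolomorphic

variable {E : Type*} [NormedAddCommGroup E] [NormedSpace ℂ E]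

/-- Continuous functions on the unit ball that are holomorphic on every complex line
through the origin. -/
structure SliceHol (f : E → ℂ) : Prop where
  continuousOn : ContinuousOn f (Metric.ball 0 1)
  slice : ∀ z : E, DifferentiableOn ℂ (fun l : ℂ => f (l • z)) {l | ‖l • z‖ < 1}

/-- The radial derivative of `f`, computed on the complex line through `z`. -/
def rad (f : E → ℂ) (z : E) : ℂ := deriv (fun l : ℂ => f (l • z)) 1

theorem isOpen_sliceDomain (z : E) : IsOpen {l : ℂ | ‖l • z‖ < 1} :=
  isOpen_lt (by fun_prop) continuous_const

theorem rad_smul (f : E → ℂ) (z : E) (l : ℂ) :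
    rad f (l • z) = l * deriv (fun m : ℂ => f (m • z)) l := by
  have h := deriv_comp_mul_left l (fun m : ℂ => f (m • z)) 1
  simpa [rad, smul_smul, mul_comm l] using h

theorem rad_zero (f : E → ℂ) : rad f 0 = 0 := by simp [rad]

/-- The path `s ↦ e^{se} z` is radial for `e = 1` and a rotation for `e = I`. Both derivatives are
multiples of the same `rad f`, so no other partial derivatives are ever needed. -/
theorem SliceHol.hasDerivAt_exp {f : E → ℂ} (hf : SliceHol f) (e : ℂ) (z : E) (s : ℝ)
    (hz : ‖Complex.exp (s * e) • z‖ < 1) :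
    HasDerivAt (fun s : ℝ => f (Complex.exp (s * e) • z))
      (e * rad f (Complex.exp (s * e) • z)) s := by
  have h1 : HasDerivAt (fun l : ℂ => f (l • z))
      (deriv (fun l : ℂ => f (l • z)) (Complex.exp (s * e))) (Complex.exp (s * e)) :=
    ((hf.slice z).differentiableAt ((isOpen_sliceDomain z).mem_nhds hz)).hasDerivAt
  have h2 : HasDerivAt (fun s : ℝ => Complex.exp (s * e)) (Complex.exp (s * e) * (1 * e)) s :=
    ((Complex.ofRealCLM.hasDerivAt (x := s)).mul_const e).cexp
  have h3 := h1.comp s h2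
  rw [rad_smul]
  refine h3.congr_deriv ?_
  ring

/-- Stability under `rad` is what makes this class convenient: second derivatives come from applying
the first-order statements to `rad f`. Continuity follows from Weierstrass' theorem, since the slice
functions converge locally uniformly as `z → z₀`. -/
theorem SliceHol.sliceHol_rad {f : E → ℂ} (hf : SliceHol f) : SliceHol (rad f) where
  continuousOn := by
    intro z₀ hz₀
    apply ContinuousAt.continuousWithinAt
    have hz₀' : ‖z₀‖ < 1 := by simpa using hz₀
    -- A radius above `1` puts the point `1`, where `rad` is evaluated, inside the open disc of
    -- convergence.
    obtain ⟨ρ, hρ1, hρ⟩ : ∃ ρ : ℝ, 1 < ρ ∧ ρ * ‖z₀‖ < 1 := by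
      have hc : Tendsto (fun ρ : ℝ => ρ * ‖z₀‖) (𝓝[>] 1) (𝓝 (1 * ‖z₀‖)) :=
        (Continuous.tendsto (by fun_prop) 1).mono_left nhdsWithin_le_nhds
      rw [one_mul] at hc
      obtain ⟨ρ, h1, h2⟩ := ((hc.eventually_lt_const hz₀').and self_mem_nhdsWithin).exists
      exact ⟨ρ, h2, h1⟩
    have hρ0 : 0 < ρ := by linarith
    have hU : TendstoLocallyUniformlyOn (fun (z : E) (l : ℂ) => f (l • z))
        (fun l : ℂ => f (l • z₀)) (𝓝 z₀) (Metric.ball 0 ρ) := by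
      rw [Metric.tendstoLocallyUniformlyOn_iff]
      intro ε hε x hx
      have hx' : x • z₀ ∈ Metric.ball (0 : E) 1 := by
        rw [mem_ball_zero_iff, norm_smul]
        rw [mem_ball_zero_iff] at hx
        exact lt_of_le_of_lt (by gcongr) hρ
      have hc : ContinuousAt (fun q : E × ℂ => f (q.2 • q.1)) (z₀, x) :=
        ContinuousAt.comp (f := fun q : E × ℂ => q.2 • q.1) (g := f)
          (hf.continuousOn.continuousAt (Metric.isOpen_ball.mem_nhds hx'))
          (Continuous.continuousAt (by fun_prop))
      have hev := Metric.tendsto_nhds.1 hc (ε / 2) (half_pos hε)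
      rw [nhds_prod_eq] at hev
      obtain ⟨V, hV, W, hW, hVW⟩ := Filter.eventually_prod_iff.1 hev
      refine ⟨{y | W y}, mem_nhdsWithin_of_mem_nhds hW, ?_⟩
      filter_upwards [hV] with z hz y hy
      have h1 := hVW hz hy
      have h2 := hVW hV.self_of_nhds hy
      have := dist_triangle_right (f (y • z₀)) (f (y • z)) (f (x • z₀))
      simp only at h1 h2
      linarith
    have hd : ∀ᶠ z in 𝓝 z₀, DifferentiableOn ℂ (fun l : ℂ => f (l • z)) (Metric.ball 0 ρ) := by
      have : ∀ᶠ z in 𝓝 z₀, ρ * ‖z‖ < 1 :=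
        (Continuous.tendsto (f := fun z : E => ρ * ‖z‖) (by fun_prop) z₀).eventually_lt_const hρ
      filter_upwards [this] with z hz
      refine (hf.slice z).mono fun l hl => ?_
      rw [mem_ball_zero_iff] at hl
      rw [mem_ofPred_eq, norm_smul]
      exact lt_of_le_of_lt (by gcongr) hz
    have h := hU.deriv hd Metric.isOpen_ball
    exact h.tendsto_at (a := 1) (by simpa using hρ1)
  slice := by
    intro z
    have h : (fun l : ℂ => rad f (l • z)) =
        fun l => l * deriv (fun m : ℂ => f (m • z)) l := funext fun l => rad_smul f z l
    rw [h]
    exact differentiableOn_id.mul ((hf.slice z).deriv (isOpen_sliceDomain z))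

/-- The radial derivative is of first order at the origin. -/
theorem SliceHol.exists_norm_rad_smul_le [FiniteDimensional ℂ E] {f : E → ℂ} (hf : SliceHol f)
    {r : ℝ} (hr : r < 1) :
    ∃ C : ℝ, 0 ≤ C ∧ ∀ z : E, ‖z‖ ≤ 1 → ∀ t : ℝ, 0 ≤ t → t ≤ r →
      ‖rad f ((t : ℂ) • z)‖ ≤ C * t := by
  have : ProperSpace E := FiniteDimensional.proper ℂ E
  by_cases hr0 : r < 0
  · exact ⟨0, le_rfl, fun z _ t h0 h1 => by linarith⟩
  push Not at hr0
  set R : ℝ := (r + 1) / 2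
  have hR : R < 1 := by simp only [R]; linarith
  have hrR : r < R := by simp only [R]; linarith
  obtain ⟨M, hM⟩ := (isCompact_closedBall (0 : E) R).exists_bound_of_continuousOn
    (hf.continuousOn.mono (Metric.closedBall_subset_ball hR))
  have hM0 : 0 ≤ M := (norm_nonneg _).trans (hM 0 (by simp; linarith))
  refine ⟨M / (R - r), div_nonneg hM0 (by linarith), fun z hz t ht htr => ?_⟩
  rw [rad_smul, norm_mul, Complex.norm_real, Real.norm_of_nonneg ht, mul_comm]
  gcongr
  have hin : ∀ l : ℂ, l ∈ Metric.closedBall (t : ℂ) (R - r) → ‖l • z‖ ≤ R := by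
    intro l hl
    rw [mem_closedBall_iff_norm] at hl
    have h1 : ‖l‖ ≤ R := by
      have := norm_add_le (l - t) (t : ℂ)
      rw [sub_add_cancel, Complex.norm_real, Real.norm_of_nonneg ht] at this
      linarith
    rw [norm_smul]
    nlinarith [norm_nonneg l, norm_nonneg z]
  -- Cauchy's estimate on the disc of radius `R - r` about `t`; the factor `t` has already been
  -- split off by `rad_smul`.
  refine Complex.norm_deriv_le_of_forall_mem_sphere_norm_le (by linarith) ?_ ?_
  · refine DifferentiableOn.diffContOnCl ?_
    rw [closure_ball _ (by linarith : R - r ≠ 0)]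
    exact (hf.slice z).mono fun l hl => lt_of_le_of_lt (hin l hl) hR
  · intro l hl
    exact hM _ (by simpa using hin l (Metric.sphere_subset_closedBall hl))

end SliceHolomorphic

theorem IsHol.sliceHol {d : ℕ} {f : Cn d → ℂ} (hf : IsHol f) : SliceHol f where
  continuousOn := DifferentiableOn.continuousOn hf
  slice z := DifferentiableOn.comp (g := f) (f := fun l : ℂ => l • z) hf
    (by fun_prop) (fun l hl => by simpa using hl)

theorem IsHol.radial_eq_rad {d : ℕ} {f : Cn d → ℂ} (hf : IsHol f) {z : Cn d} (hz : ‖z‖ < 1) :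
    radial f z = rad f z := by
  have h1 : HasFDerivAt f (fderiv ℂ f z) ((1 : ℂ) • z) := by
    rw [one_smul]
    exact (DifferentiableOn.differentiableAt hf
      (Metric.isOpen_ball.mem_nhds (by simpa using hz))).hasFDerivAt
  have h2 : HasDerivAt (fun l : ℂ => l • z) ((1 : ℂ) • z) 1 := (hasDerivAt_id (1 : ℂ)).smul_const z
  have h3 : rad f z = fderiv ℂ f z z := by
    have := (h1.comp_hasDerivAt (1 : ℂ) h2).deriv
    rw [one_smul] at this
    exact this
  rw [h3, radial]
  conv_rhs => arg 2; rw [← (EuclideanSpace.basisFun (Fin d) ℂ).sum_repr z]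
  simp

/-! ### The normalized surface measure and its rotation invariance -/

instance isFiniteMeasure_surface (d : ℕ) : IsFiniteMeasure (surface d) :=
  inferInstanceAs (IsFiniteMeasure ((volume : Measure (Cn d)).toSphere))

/-- The condition `d ≥ 1` enters the proof only here: it makes the surface measure nonzero. -/
theorem isProbabilityMeasure_sigma {d : ℕ} (hd : 1 ≤ d) : IsProbabilityMeasure (sigma d) := by
  have : Nonempty (Fin d) := ⟨⟨0, hd⟩⟩
  have : Nontrivial (Cn d) := inferInstance
  have h : surface d ≠ 0 := Measure.toSphere_ne_zero _
  have : NeZero (surface d) := ⟨h⟩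
  exact isProbabilityMeasureSMul

/-- Multiplication by a unimodular scalar as a self-homeomorphism of the unit sphere. -/
def rotate {d : ℕ} (c : Circle) :
    Metric.sphere (0 : Cn d) 1 ≃ₜ Metric.sphere (0 : Cn d) 1 where
  toFun z := ⟨(c : ℂ) • (z : Cn d), by simp [norm_smul, Circle.norm_coe]⟩
  invFun z := ⟨((c⁻¹ : Circle) : ℂ) • (z : Cn d), by simp [norm_smul, Circle.norm_coe]⟩
  left_inv z := by ext1; simp [smul_smul]
  right_inv z := by ext1; simp [smul_smul]
  continuous_toFun := by fun_prop
  continuous_invFun := by fun_prop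

/-- The surface measure of a set is a multiple of the volume of the cone over it, and a unimodular
scalar acts as a real linear isometry carrying cones to cones. -/
theorem measurePreserving_rotate {d : ℕ} (c : Circle) :
    MeasurePreserving (rotate (d := d) c) (sigma d) (sigma d) := by
  refine MeasurePreserving.smul_measure ⟨(rotate c).continuous.measurable, ?_⟩ _
  ext s hs
  rw [Measure.map_apply (rotate c).continuous.measurable hs, surface,
    Measure.toSphere_apply' _ hs,
    Measure.toSphere_apply' _ ((rotate c).continuous.measurable hs)]
  congr 1
  let L : Cn d ≃ₗᵢ[ℝ] Cn d :=
    { toFun := fun z => (c : ℂ) • z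
      invFun := fun z => ((c⁻¹ : Circle) : ℂ) • z
      map_add' := smul_add _
      map_smul' := fun a z => smul_comm _ _ _
      left_inv := fun z => by simp [smul_smul]
      right_inv := fun z => by simp [smul_smul]
      norm_map' := fun z => by
        change ‖(c : ℂ) • z‖ = ‖z‖
        rw [norm_smul, Circle.norm_coe, one_mul] }
  have hL : ∀ z, L z = (c : ℂ) • z := fun z => rfl
  refine Eq.trans ?_
    (L.measurePreserving.measure_preimage_emb L.toHomeomorph.measurableEmbedding _)
  congr 1
  ext z
  rw [mem_preimage, Set.mem_smul, Set.mem_smul]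
  constructor
  · rintro ⟨a, ha, _, ⟨ζ, hζ, rfl⟩, rfl⟩
    exact ⟨a, ha, _, ⟨_, hζ, rfl⟩, smul_comm _ _ _⟩
  · rintro ⟨a, ha, _, ⟨ζ, hζ, rfl⟩, h⟩
    refine ⟨a, ha, _, ⟨(rotate c).symm ζ, by simpa using hζ, rfl⟩, L.injective ?_⟩
    refine Eq.trans ?_ h
    refine (map_smul L a _).trans (congrArg (a • ·) ?_)
    exact congrArg Subtype.val ((rotate c).apply_symm_apply ζ)

theorem lintegral_rotate {d : ℕ} (c : Circle) (g : Metric.sphere (0 : Cn d) 1 → ℝ≥0∞) :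
    ∫⁻ ζ, g (rotate c ζ) ∂(sigma d) = ∫⁻ ζ, g ζ ∂(sigma d) :=
  (measurePreserving_rotate c).lintegral_comp_emb (rotate c).measurableEmbedding g

theorem integral_rotate {d : ℕ} (c : Circle) (g : Metric.sphere (0 : Cn d) 1 → ℝ) :
    ∫ ζ, g (rotate c ζ) ∂(sigma d) = ∫ ζ, g ζ ∂(sigma d) :=
  (measurePreserving_rotate c).integral_comp (rotate c).measurableEmbedding g

/-- Differentiation under the integral sign over a compact space. -/
theorem hasDerivAt_integral_of_compact {X : Type*} [TopologicalSpace X] [CompactSpace X]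
    [MeasurableSpace X] [OpensMeasurableSpace X]
    [SecondCountableTopology X] {μ : Measure X} [IsFiniteMeasure μ]
    {U : Set ℝ} (hU : IsOpen U) {u u' : ℝ → X → ℝ}
    (hu : ContinuousOn (fun q : ℝ × X => u q.1 q.2) (U ×ˢ univ))
    (hu' : ContinuousOn (fun q : ℝ × X => u' q.1 q.2) (U ×ˢ univ))
    (hderiv : ∀ t ∈ U, ∀ x, HasDerivAt (fun t => u t x) (u' t x) t) {t : ℝ} (ht : t ∈ U) :
    HasDerivAt (fun t => ∫ x, u t x ∂μ) (∫ x, u' t x ∂μ) t := by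
  have hc : ∀ {v : ℝ → X → ℝ}, ContinuousOn (fun q : ℝ × X => v q.1 q.2) (U ×ˢ univ) →
      ∀ {t}, t ∈ U → Continuous (v t) := by
    intro v hv t ht
    exact hv.comp_continuous (f := fun x : X => (t, x)) (by fun_prop) (fun x => ⟨ht, mem_univ _⟩)
  obtain ⟨ε, hε, hball⟩ := Metric.nhds_basis_closedBall.mem_iff.1 (hU.mem_nhds ht)
  obtain ⟨M, hM⟩ := ((isCompact_closedBall t ε).prod
    (isCompact_univ (X := X))).exists_bound_of_continuousOn
    (hu'.mono (prod_mono hball subset_rfl))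
  refine (hasDerivAt_integral_of_dominated_loc_of_deriv_le (bound := fun _ => M)
    (Metric.closedBall_mem_nhds t hε) ?_ ?_ ?_ ?_ (integrable_const M) ?_).2
  · filter_upwards [hU.mem_nhds ht] with s hs using (hc hu hs).aestronglyMeasurable
  · exact (hc hu ht).integrable_of_hasCompactSupport (HasCompactSupport.of_compactSpace _)
  · exact (hc hu' ht).aestronglyMeasurable
  · exact .of_forall fun x s hs => hM (s, x) ⟨hs, mem_univ _⟩
  · exact .of_forall fun x s hs => hderiv s (hball hs) x

theorem continuousOn_integral_of_compact {X : Type*} [TopologicalSpace X] [CompactSpace X]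
    [MeasurableSpace X] [OpensMeasurableSpace X]
    [SecondCountableTopology X] {μ : Measure X} [IsFiniteMeasure μ]
    {U : Set ℝ} (hU : IsOpen U) {u : ℝ → X → ℝ}
    (hu : ContinuousOn (fun q : ℝ × X => u q.1 q.2) (U ×ˢ univ)) :
    ContinuousOn (fun t => ∫ x, u t x ∂μ) U := by
  intro t ht
  apply ContinuousAt.continuousWithinAt
  have hc : ∀ {t}, t ∈ U → Continuous (u t) := fun {t} ht =>
    hu.comp_continuous (f := fun x : X => (t, x)) (by fun_prop) (fun x => ⟨ht, mem_univ _⟩)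
  obtain ⟨ε, hε, hball⟩ := Metric.nhds_basis_closedBall.mem_iff.1 (hU.mem_nhds ht)
  obtain ⟨M, hM⟩ := ((isCompact_closedBall t ε).prod
    (isCompact_univ (X := X))).exists_bound_of_continuousOn
    (hu.mono (prod_mono hball subset_rfl))
  refine continuousAt_of_dominated (bound := fun _ => M) ?_ ?_ (integrable_const M) ?_
  · filter_upwards [hU.mem_nhds ht] with s hs using (hc hs).aestronglyMeasurable
  · filter_upwards [Metric.closedBall_mem_nhds t hε] with s hs
    exact .of_forall fun x => hM (s, x) ⟨hs, mem_univ _⟩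
  · refine .of_forall fun x => ?_
    exact ContinuousAt.comp (f := fun t : ℝ => (t, x))
      (hu.continuousAt ((hU.prod isOpen_univ).mem_nhds ⟨ht, mem_univ _⟩))
      (Continuous.continuousAt (by fun_prop))

/-! ### Pointwise calculus for `(‖w‖² + ε)^{p/2}` -/

section Kernel

/-- Up to the factor `p`, the differential of `(‖w‖ ^ 2 + ε) ^ (p / 2)` in the direction `a` is
`Re (kern p ε w * a)`. -/
def kern (p ε : ℝ) (w : ℂ) : ℂ := ((‖w‖ ^ 2 + ε) ^ (p / 2 - 1) : ℝ) * conj w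

/-- The differential of `kern p ε` at `w` in the direction `a`. -/
def dkern (p ε : ℝ) (w a : ℂ) : ℂ :=
  ((p / 2 - 1) * (‖w‖ ^ 2 + ε) ^ (p / 2 - 2) * (2 * (conj w * a).re) : ℝ) * conj w +
    ((‖w‖ ^ 2 + ε) ^ (p / 2 - 1) : ℝ) * conj a

/-- Up to the factor `p`, the Laplacian of `(‖g‖ ^ 2 + ε) ^ (p / 2)` for a holomorphic `g` with
value `w` and derivative `a`. -/
def lapl (p ε : ℝ) (w a : ℂ) : ℝ :=
  (p - 2) * (‖w‖ ^ 2 + ε) ^ (p / 2 - 2) * (‖w‖ ^ 2 * ‖a‖ ^ 2) +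
    2 * (‖w‖ ^ 2 + ε) ^ (p / 2 - 1) * ‖a‖ ^ 2

variable {p ε : ℝ}

theorem hasDerivAt_norm_sq_add {g : ℝ → ℂ} {a : ℂ} {s : ℝ} (hg : HasDerivAt g a s) :
    HasDerivAt (fun s => ‖g s‖ ^ 2 + ε) (2 * (conj (g s) * a).re) s := by
  have h := (hg.norm_sq).add_const ε
  refine h.congr_deriv ?_
  rw [Complex.inner, mul_comm (conj _)]

theorem hasDerivAt_norm_sq_add_rpow (hε : 0 < ε) {g : ℝ → ℂ} {a : ℂ} {s : ℝ}
    (hg : HasDerivAt g a s) :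
    HasDerivAt (fun s => (‖g s‖ ^ 2 + ε) ^ (p / 2)) (p * (kern p ε (g s) * a).re) s := by
  have h := (hasDerivAt_norm_sq_add (ε := ε) hg).rpow_const (p := p / 2)
    (Or.inl (by positivity))
  refine h.congr_deriv ?_
  have h2 : (kern p ε (g s) * a).re =
      (‖g s‖ ^ 2 + ε) ^ (p / 2 - 1) * (conj (g s) * a).re := by
    rw [kern, mul_assoc, Complex.re_ofReal_mul]
  rw [h2]
  ring

theorem hasDerivAt_kern (hε : 0 < ε) {g : ℝ → ℂ} {a : ℂ} {s : ℝ} (hg : HasDerivAt g a s) :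
    HasDerivAt (fun s => kern p ε (g s)) (dkern p ε (g s) a) s := by
  have h := ((hasDerivAt_norm_sq_add (ε := ε) hg).rpow_const (p := p / 2 - 1)
    (Or.inl (by positivity))).ofReal_comp.mul
    (Complex.conjCLE.toContinuousLinearMap.hasFDerivAt.comp_hasDerivAt s hg)
  refine h.congr_deriv ?_
  rw [dkern, show p / 2 - 1 - 1 = p / 2 - 2 by ring]
  simp only [Function.comp, ContinuousLinearEquiv.coe_coe, Complex.conjCLE_apply]
  push_cast
  ring

theorem continuous_kern (hε : 0 < ε) : Continuous (kern p ε) := by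
  have h : Continuous fun w : ℂ => (‖w‖ ^ 2 + ε) ^ (p / 2 - 1) :=
    Continuous.rpow_const (by fun_prop) fun w => Or.inl (by positivity)
  unfold kern
  fun_prop

theorem continuous_dkern (hε : 0 < ε) : Continuous (fun q : ℂ × ℂ => dkern p ε q.1 q.2) := by
  have h (m : ℝ) : Continuous fun q : ℂ × ℂ => (‖q.1‖ ^ 2 + ε) ^ m :=
    Continuous.rpow_const (by fun_prop) fun w => Or.inl (by positivity)
  have h1 := h (p / 2 - 1)
  have h2 := h (p / 2 - 2)
  have h3 : Continuous fun q : ℂ × ℂ => (conj q.1 * q.2).re :=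
    Complex.continuous_re.comp (by fun_prop)
  unfold dkern
  fun_prop

theorem continuous_lapl (hε : 0 < ε) : Continuous (fun q : ℂ × ℂ => lapl p ε q.1 q.2) := by
  have h (m : ℝ) : Continuous fun q : ℂ × ℂ => (‖q.1‖ ^ 2 + ε) ^ m :=
    Continuous.rpow_const (by fun_prop) fun w => Or.inl (by positivity)
  have h1 := h (p / 2 - 1)
  have h2 := h (p / 2 - 2)
  unfold lapl
  fun_prop

/-- The second derivative `b` cancels because `1² + I² = 0`, which is the harmonicity of holomorphic
functions; the squared real and imaginary parts of `conj w * a` add up to `‖w‖² ‖a‖²`. -/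
theorem dkern_add_dkern_I (w a b : ℂ) :
    (dkern p ε w (1 * a) * (1 * a) + kern p ε w * (1 * (1 * b))).re +
      (dkern p ε w (Complex.I * a) * (Complex.I * a) +
        kern p ε w * (Complex.I * (Complex.I * b))).re = lapl p ε w a := by
  have hw : ‖w‖ ^ 2 = w.re ^ 2 + w.im ^ 2 := by
    rw [← Complex.normSq_eq_norm_sq, Complex.normSq_apply]; ring
  have ha : ‖a‖ ^ 2 = a.re ^ 2 + a.im ^ 2 := by
    rw [← Complex.normSq_eq_norm_sq, Complex.normSq_apply]; ring
  rw [lapl, dkern, dkern, kern]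
  generalize hm : (‖w‖ ^ 2 + ε) ^ (p / 2 - 1) = m
  generalize hn : (‖w‖ ^ 2 + ε) ^ (p / 2 - 2) = n
  rw [hw, ha]
  simp only [Complex.add_re, Complex.mul_re, Complex.mul_im, Complex.add_im, Complex.ofReal_re,
    Complex.ofReal_im, Complex.conj_re, Complex.conj_im, Complex.I_re, Complex.I_im,
    Complex.one_re, Complex.one_im]
  ring

theorem lapl_nonneg (hp : 2 ≤ p) (hε : 0 < ε) (w a : ℂ) : 0 ≤ lapl p ε w a := by
  have : 0 ≤ p - 2 := by linarith
  unfold lapl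
  positivity

/-- Replacing `‖w‖²` by `‖w‖² + ε` in the first term gives both terms the same power, with total
coefficient `(p - 2) + 2 = p`. -/
theorem lapl_le (hp : 2 ≤ p) (hε : 0 < ε) (w a : ℂ) :
    lapl p ε w a ≤ p * ((‖w‖ ^ 2 + ε) ^ (p / 2 - 1) * ‖a‖ ^ 2) := by
  have hx : 0 < ‖w‖ ^ 2 + ε := by positivity
  have h : (‖w‖ ^ 2 + ε) ^ (p / 2 - 1) = (‖w‖ ^ 2 + ε) ^ (p / 2 - 2) * (‖w‖ ^ 2 + ε) := by
    rw [← Real.rpow_add_one hx.ne']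
    congr 1
    ring
  have h2 : 0 ≤ (p - 2) * (‖w‖ ^ 2 + ε) ^ (p / 2 - 2) * (ε * ‖a‖ ^ 2) := by
    have : 0 ≤ p - 2 := by linarith
    positivity
  rw [lapl, h]
  linarith

end Kernel

/-! ### Derivatives of the regularized means in logarithmic coordinates -/

section HardyStein

variable {d : ℕ} {p ε : ℝ} {f : Cn d → ℂ}

/-- The regularized integral mean `∫ (|f(rζ)|² + ε)^{p/2} dσ(ζ)`. -/
def regMean (p ε : ℝ) (f : Cn d → ℂ) (l : ℂ) : ℝ :=
  ∫ ζ : Metric.sphere (0 : Cn d) 1, (‖f (l • (ζ : Cn d))‖ ^ 2 + ε) ^ (p / 2) ∂(sigma d)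

/-- The mean of the derivative of `(|f|² + ε)^{p/2}`, in the direction `e` in logarithmic
coordinates. -/
def pairMean (p ε : ℝ) (f : Cn d → ℂ) (e l : ℂ) : ℝ :=
  ∫ ζ : Metric.sphere (0 : Cn d) 1,
    (kern p ε (f (l • (ζ : Cn d))) * (e * rad f (l • (ζ : Cn d)))).re ∂(sigma d)

/-- The mean of the Laplacian of `(|f|² + ε)^{p/2}` in logarithmic coordinates. -/
def laplMean (p ε : ℝ) (f : Cn d → ℂ) (l : ℂ) : ℝ :=
  ∫ ζ : Metric.sphere (0 : Cn d) 1,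
    lapl p ε (f (l • (ζ : Cn d))) (rad f (l • (ζ : Cn d))) ∂(sigma d)

theorem norm_smul_sphere (l : ℂ) (ζ : Metric.sphere (0 : Cn d) 1) : ‖l • (ζ : Cn d)‖ = ‖l‖ := by
  simp [norm_smul]

theorem continuousOn_comp_smul_sphere {T : Type*} [TopologicalSpace T] {c : T → ℂ}
    (hc : Continuous c) {g : Cn d → ℂ} (hg : ContinuousOn g (Metric.ball 0 1)) :
    ContinuousOn (fun q : T × Metric.sphere (0 : Cn d) 1 => g (c q.1 • (q.2 : Cn d)))
      ({s | ‖c s‖ < 1} ×ˢ univ) := by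
  refine hg.comp (by fun_prop) ?_
  rintro ⟨s, ζ⟩ ⟨hs, -⟩
  rw [mem_ball_zero_iff, norm_smul_sphere]
  exact hs

theorem continuous_comp_smul_sphere {g : Cn d → ℂ} (hg : ContinuousOn g (Metric.ball 0 1))
    {l : ℂ} (hl : ‖l‖ < 1) :
    Continuous (fun ζ : Metric.sphere (0 : Cn d) 1 => g (l • (ζ : Cn d))) := by
  refine hg.comp_continuous (by fun_prop) fun ζ => ?_
  rwa [mem_ball_zero_iff, norm_smul_sphere]

variable (hf : SliceHol f)
include hf

/-- Every integrand over the sphere in the differentiation argument is a continuous function `Ψ` of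
`f`, `Rf` and `RRf`, so one statement serves them all. -/
theorem continuousOn_jet {Ψ : ℂ → ℂ → ℂ → ℝ}
    (hΨ : Continuous fun q : ℂ × ℂ × ℂ => Ψ q.1 q.2.1 q.2.2)
    {T : Type*} [TopologicalSpace T] {c : T → ℂ} (hc : Continuous c) :
    ContinuousOn (fun q : T × Metric.sphere (0 : Cn d) 1 =>
      Ψ (f (c q.1 • (q.2 : Cn d))) (rad f (c q.1 • (q.2 : Cn d)))
        (rad (rad f) (c q.1 • (q.2 : Cn d)))) ({s | ‖c s‖ < 1} ×ˢ univ) := by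
  have h0 := continuousOn_comp_smul_sphere hc hf.continuousOn
  have h1 := continuousOn_comp_smul_sphere hc hf.sliceHol_rad.continuousOn
  have h2 := continuousOn_comp_smul_sphere hc hf.sliceHol_rad.sliceHol_rad.continuousOn
  exact hΨ.comp_continuousOn (h0.prodMk (h1.prodMk h2))

theorem integrable_jet [IsFiniteMeasure (sigma d)] {Ψ : ℂ → ℂ → ℂ → ℝ}
    (hΨ : Continuous fun q : ℂ × ℂ × ℂ => Ψ q.1 q.2.1 q.2.2) {l : ℂ} (hl : ‖l‖ < 1) :
    Integrable (fun ζ : Metric.sphere (0 : Cn d) 1 =>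
      Ψ (f (l • (ζ : Cn d))) (rad f (l • (ζ : Cn d))) (rad (rad f) (l • (ζ : Cn d))))
      (sigma d) := by
  have h0 := continuous_comp_smul_sphere (d := d) hf.continuousOn hl
  have h1 := continuous_comp_smul_sphere (d := d) hf.sliceHol_rad.continuousOn hl
  have h2 := continuous_comp_smul_sphere (d := d) hf.sliceHol_rad.sliceHol_rad.continuousOn hl
  exact (hΨ.comp (h0.prodMk (h1.prodMk h2))).integrable_of_hasCompactSupport
    (HasCompactSupport.of_compactSpace _)

omit hf in
theorem continuous_rpow_jet (hε : 0 < ε) :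
    Continuous fun q : ℂ × ℂ × ℂ => (‖q.1‖ ^ 2 + ε) ^ (p / 2) :=
  Continuous.rpow_const (by fun_prop) fun w => Or.inl (by positivity)

omit hf in
theorem continuous_pair_jet (hε : 0 < ε) (e : ℂ) :
    Continuous fun q : ℂ × ℂ × ℂ => (kern p ε q.1 * (e * q.2.1)).re := by
  have h := (continuous_kern (p := p) hε).comp (continuous_fst (X := ℂ) (Y := ℂ × ℂ))
  exact Complex.continuous_re.comp (h.mul (by fun_prop))

omit hf in
theorem continuous_lapl_jet (hε : 0 < ε) :
    Continuous fun q : ℂ × ℂ × ℂ => lapl p ε q.1 q.2.1 :=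
  (continuous_lapl hε).comp (f := fun q : ℂ × ℂ × ℂ => (q.1, q.2.1)) (by fun_prop)

omit hf in
theorem continuous_deriv_pair_jet (hε : 0 < ε) (e : ℂ) :
    Continuous fun q : ℂ × ℂ × ℂ =>
      (dkern p ε q.1 (e * q.2.1) * (e * q.2.1) + kern p ε q.1 * (e * (e * q.2.2))).re := by
  have h := (continuous_kern (p := p) hε).comp (continuous_fst (X := ℂ) (Y := ℂ × ℂ))
  have h' := (continuous_dkern (p := p) hε).comp
    (f := fun q : ℂ × ℂ × ℂ => (q.1, e * q.2.1)) (by fun_prop)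
  exact Complex.continuous_re.comp ((h'.mul (by fun_prop)).add (h.mul (by fun_prop)))

theorem hasDerivAt_exp_sphere (e l : ℂ) (ζ : Metric.sphere (0 : Cn d) 1) {s : ℝ}
    (hs : ‖Complex.exp (s * e) * l‖ < 1) :
    HasDerivAt (fun s : ℝ => f ((Complex.exp (s * e) * l) • (ζ : Cn d)))
      (e * rad f ((Complex.exp (s * e) * l) • (ζ : Cn d))) s := by
  have h := hf.hasDerivAt_exp e (l • (ζ : Cn d)) s (by rwa [smul_smul, norm_smul_sphere])
  simpa only [smul_smul] using h

variable [IsFiniteMeasure (sigma d)]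

theorem hasDerivAt_regMean (hε : 0 < ε) (e l : ℂ) {s : ℝ}
    (hs : ‖Complex.exp (s * e) * l‖ < 1) :
    HasDerivAt (fun s : ℝ => regMean p ε f (Complex.exp (s * e) * l))
      (p * pairMean p ε f e (Complex.exp (s * e) * l)) s := by
  have hc : Continuous fun s : ℝ => Complex.exp (s * e) * l := by fun_prop
  have hk : Continuous fun q : ℂ × ℂ × ℂ => p * (kern p ε q.1 * (e * q.2.1)).re :=
    continuous_const.mul (continuous_pair_jet hε e)
  have hu := continuousOn_jet hf (Ψ := fun w _ _ => (‖w‖ ^ 2 + ε) ^ (p / 2))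
    (continuous_rpow_jet hε) hc
  have hu' := continuousOn_jet hf (Ψ := fun w a _ => p * (kern p ε w * (e * a)).re) hk hc
  have h := hasDerivAt_integral_of_compact (μ := sigma d)
    (U := {s : ℝ | ‖Complex.exp (s * e) * l‖ < 1}) (isOpen_lt (by fun_prop) continuous_const)
    (u := fun s ζ => (‖f ((Complex.exp (s * e) * l) • (ζ : Cn d))‖ ^ 2 + ε) ^ (p / 2))
    (u' := fun s ζ => p * (kern p ε (f ((Complex.exp (s * e) * l) • (ζ : Cn d))) *
      (e * rad f ((Complex.exp (s * e) * l) • (ζ : Cn d)))).re) hu hu'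
    (fun t ht ζ => hasDerivAt_norm_sq_add_rpow hε (hasDerivAt_exp_sphere hf e l ζ ht)) hs
  rw [integral_const_mul] at h
  exact h

theorem hasDerivAt_pairMean (hε : 0 < ε) (e l : ℂ) {s : ℝ}
    (hs : ‖Complex.exp (s * e) * l‖ < 1) :
    HasDerivAt (fun s : ℝ => pairMean p ε f e (Complex.exp (s * e) * l))
      (∫ ζ : Metric.sphere (0 : Cn d) 1,
        (dkern p ε (f ((Complex.exp (s * e) * l) • (ζ : Cn d)))
            (e * rad f ((Complex.exp (s * e) * l) • (ζ : Cn d))) *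
            (e * rad f ((Complex.exp (s * e) * l) • (ζ : Cn d))) +
          kern p ε (f ((Complex.exp (s * e) * l) • (ζ : Cn d))) *
            (e * (e * rad (rad f) ((Complex.exp (s * e) * l) • (ζ : Cn d))))).re ∂(sigma d)) s := by
  have hc : Continuous fun s : ℝ => Complex.exp (s * e) * l := by fun_prop
  have hu := continuousOn_jet hf (Ψ := fun w a _ => (kern p ε w * (e * a)).re)
    (continuous_pair_jet hε e) hc
  have hu' := continuousOn_jet hf (Ψ := fun w a b =>
    (dkern p ε w (e * a) * (e * a) + kern p ε w * (e * (e * b))).re)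
    (continuous_deriv_pair_jet hε e) hc
  refine hasDerivAt_integral_of_compact (μ := sigma d)
    (U := {s : ℝ | ‖Complex.exp (s * e) * l‖ < 1}) (isOpen_lt (by fun_prop) continuous_const)
    (u := fun s ζ => (kern p ε (f ((Complex.exp (s * e) * l) • (ζ : Cn d))) *
      (e * rad f ((Complex.exp (s * e) * l) • (ζ : Cn d)))).re)
    (u' := fun s ζ => (dkern p ε (f ((Complex.exp (s * e) * l) • (ζ : Cn d)))
            (e * rad f ((Complex.exp (s * e) * l) • (ζ : Cn d))) *
            (e * rad f ((Complex.exp (s * e) * l) • (ζ : Cn d))) +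
          kern p ε (f ((Complex.exp (s * e) * l) • (ζ : Cn d))) *
            (e * (e * rad (rad f) ((Complex.exp (s * e) * l) • (ζ : Cn d))))).re)
    hu hu' ?_ hs
  · intro t ht ζ
    have h1 := hasDerivAt_kern (p := p) hε (hasDerivAt_exp_sphere hf e l ζ ht)
    have h2 := (hasDerivAt_exp_sphere hf.sliceHol_rad e l ζ ht).const_mul e
    exact Complex.reCLM.hasFDerivAt.comp_hasDerivAt t (h1.mul h2)

/-- The mean of the derivative along the rotations vanishes. -/
theorem integral_pair_I_eq_zero (hε : 0 < ε) {l : ℂ} (hl : ‖l‖ < 1) :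
    ∫ ζ : Metric.sphere (0 : Cn d) 1,
      (dkern p ε (f (l • (ζ : Cn d))) (Complex.I * rad f (l • (ζ : Cn d))) *
          (Complex.I * rad f (l • (ζ : Cn d))) +
        kern p ε (f (l • (ζ : Cn d))) *
          (Complex.I * (Complex.I * rad (rad f) (l • (ζ : Cn d))))).re ∂(sigma d) = 0 := by
  have h := hasDerivAt_pairMean (p := p) hf hε Complex.I l (s := 0) (by simpa using hl)
  -- Varying `s` only rotates the sphere, so this mean is constant; its derivative at `s = 0` is the
  -- integral in question.
  have hconst : (fun s : ℝ => pairMean p ε f Complex.I (Complex.exp (s * Complex.I) * l)) =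
      fun _ => pairMean p ε f Complex.I l := by
    funext s
    have hrot := integral_rotate (Circle.exp s) fun ζ : Metric.sphere (0 : Cn d) 1 =>
      (kern p ε (f (l • (ζ : Cn d))) * (Complex.I * rad f (l • (ζ : Cn d)))).re
    rw [pairMean, pairMean, ← hrot]
    refine integral_congr_ae (.of_forall fun ζ => ?_)
    have : (Complex.exp (s * Complex.I) * l) • (ζ : Cn d) =
        l • (rotate (Circle.exp s) ζ : Cn d) := by
      rw [mul_comm, mul_smul]
      rfl
    simp only [this]
  rw [hconst] at h
  have h0 : Complex.exp ((0 : ℝ) * Complex.I) * l = l := by simp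
  simp only [h0] at h
  exact h.unique (hasDerivAt_const _ _)

theorem hasDerivAt_pairMean_one (hε : 0 < ε) {s : ℝ} (hs : s < 0) :
    HasDerivAt (fun s : ℝ => pairMean p ε f 1 (Real.exp s : ℝ))
      (laplMean p ε f (Real.exp s : ℝ)) s := by
  have hl : ‖((Real.exp s : ℝ) : ℂ)‖ < 1 := by
    rw [Complex.norm_real, Real.norm_of_nonneg (Real.exp_pos s).le]
    simpa using hs
  have hl' : ‖Complex.exp (s * 1) * 1‖ < 1 := by simpa using hl
  have h := hasDerivAt_pairMean (p := p) hf hε 1 1 hl'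
  simp only [mul_one, ← Complex.ofReal_exp] at h
  refine h.congr_deriv ?_
  have h0 := integral_pair_I_eq_zero (p := p) hf hε hl
  -- Adding the vanishing rotational second derivative completes the radial one to the Laplacian.
  rw [← add_zero (integral _ _), ← h0, ← integral_add, laplMean]
  · refine integral_congr_ae (.of_forall fun ζ => ?_)
    exact dkern_add_dkern_I _ _ _
  · exact integrable_jet hf (Ψ := fun w a b =>
      (dkern p ε w (1 * a) * (1 * a) + kern p ε w * (1 * (1 * b))).re)
      (continuous_deriv_pair_jet hε 1) hl
  · exact integrable_jet hf (Ψ := fun w a b =>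
      (dkern p ε w (Complex.I * a) * (Complex.I * a) +
        kern p ε w * (Complex.I * (Complex.I * b))).re)
      (continuous_deriv_pair_jet hε Complex.I) hl

theorem hasDerivAt_regMean_one (hε : 0 < ε) {s : ℝ} (hs : s < 0) :
    HasDerivAt (fun s : ℝ => regMean p ε f (Real.exp s : ℝ))
      (p * pairMean p ε f 1 (Real.exp s : ℝ)) s := by
  have hl' : ‖Complex.exp (s * 1) * 1‖ < 1 := by
    simpa [Complex.norm_exp] using hs
  have h := hasDerivAt_regMean (p := p) hf hε 1 1 hl'
  simpa only [mul_one, ← Complex.ofReal_exp] using h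

end HardyStein

/-! ### Hardy–Stein formula and Littlewood–Paley inequality -/

section LittlewoodPaley

variable {d : ℕ} {p ε : ℝ} {f : Cn d → ℂ}

theorem isOpen_norm_ofReal_lt_one : IsOpen {t : ℝ | ‖(t : ℂ)‖ < 1} :=
  isOpen_lt (by fun_prop) continuous_const

theorem norm_ofReal_lt_one {t : ℝ} (ht : t ∈ Ico (0 : ℝ) 1) : ‖(t : ℂ)‖ < 1 := by
  rw [Complex.norm_real, Real.norm_of_nonneg ht.1]
  exact ht.2

section

variable [IsProbabilityMeasure (sigma d)] (hf : SliceHol f) (hε : 0 < ε)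
include hf hε

theorem continuousOn_regMean : ContinuousOn (fun t : ℝ => regMean p ε f t) {t | ‖(t : ℂ)‖ < 1} := by
  have hu := continuousOn_jet hf (Ψ := fun w _ _ => (‖w‖ ^ 2 + ε) ^ (p / 2))
    (continuous_rpow_jet hε) Complex.continuous_ofReal
  exact continuousOn_integral_of_compact isOpen_norm_ofReal_lt_one hu

theorem continuousOn_pairMean :
    ContinuousOn (fun t : ℝ => pairMean p ε f 1 t) {t | ‖(t : ℂ)‖ < 1} := by
  have hu := continuousOn_jet hf (Ψ := fun w a _ => (kern p ε w * (1 * a)).re)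
    (continuous_pair_jet hε 1) Complex.continuous_ofReal
  exact continuousOn_integral_of_compact isOpen_norm_ofReal_lt_one hu

theorem continuousOn_laplMean :
    ContinuousOn (fun t : ℝ => laplMean p ε f t) {t | ‖(t : ℂ)‖ < 1} := by
  have hu := continuousOn_jet hf (Ψ := fun w a _ => lapl p ε w a)
    (continuous_lapl_jet hε) Complex.continuous_ofReal
  exact continuousOn_integral_of_compact isOpen_norm_ofReal_lt_one hu

theorem hasDerivAt_regMean_ofReal {t : ℝ} (ht : t ∈ Ioo (0 : ℝ) 1) :
    HasDerivAt (fun t : ℝ => regMean p ε f t) (p * pairMean p ε f 1 t / t) t := by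
  have h := (hasDerivAt_regMean_one (p := p) hf hε (Real.log_neg ht.1 ht.2)).comp t
    (Real.hasDerivAt_log ht.1.ne')
  rw [Real.exp_log ht.1] at h
  refine (h.congr_of_eventuallyEq ?_).congr_deriv (by rw [div_eq_mul_inv])
  filter_upwards [lt_mem_nhds ht.1] with x hx
  simp only [Function.comp, Real.exp_log hx]

theorem hasDerivAt_pairMean_ofReal {t : ℝ} (ht : t ∈ Ioo (0 : ℝ) 1) :
    HasDerivAt (fun t : ℝ => pairMean p ε f 1 t) (laplMean p ε f t / t) t := by
  have h := (hasDerivAt_pairMean_one (p := p) hf hε (Real.log_neg ht.1 ht.2)).comp t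
    (Real.hasDerivAt_log ht.1.ne')
  rw [Real.exp_log ht.1] at h
  refine (h.congr_of_eventuallyEq ?_).congr_deriv (by rw [div_eq_mul_inv])
  filter_upwards [lt_mem_nhds ht.1] with x hx
  simp only [Function.comp, Real.exp_log hx]

/-- Linear decay at `0` beats the logarithm in the boundary term of the Hardy–Stein formula. -/
theorem exists_abs_pairMean_le {r : ℝ} (hr0 : 0 < r) (hr : r < 1) :
    ∃ C : ℝ, 0 ≤ C ∧ ∀ t : ℝ, 0 ≤ t → t ≤ r → |pairMean p ε f 1 t| ≤ C * t := by
  obtain ⟨C, hC0, hC⟩ := hf.exists_norm_rad_smul_le hr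
  obtain ⟨M, hM⟩ := (isCompact_closedBall (0 : Cn d) r).exists_bound_of_continuousOn
    ((continuous_kern (p := p) hε).comp_continuousOn
      (hf.continuousOn.mono (Metric.closedBall_subset_ball hr)))
  have hM0 : 0 ≤ M := (norm_nonneg _).trans (hM 0 (by simpa using hr0.le))
  refine ⟨M * C, by positivity, fun t ht htr => ?_⟩
  have h := norm_integral_le_of_norm_le_const (μ := sigma d) (C := M * C * t)
    (f := fun ζ : Metric.sphere (0 : Cn d) 1 =>
      (kern p ε (f ((t : ℂ) • (ζ : Cn d))) * (1 * rad f ((t : ℂ) • (ζ : Cn d)))).re) ?_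
  · rw [pairMean, ← Real.norm_eq_abs]
    exact h.trans_eq (by simp)
  · refine .of_forall fun ζ => ?_
    refine (Complex.abs_re_le_norm _).trans ?_
    rw [one_mul, norm_mul, mul_assoc]
    refine mul_le_mul (hM _ ?_) (hC _ (by simp) t ht htr) (norm_nonneg _) hM0
    rw [mem_closedBall_zero_iff, norm_smul_sphere, Complex.norm_real, Real.norm_of_nonneg ht]
    exact htr

omit [IsProbabilityMeasure (sigma d)] hf hε in
theorem pairMean_zero : pairMean p ε f 1 (0 : ℝ) = 0 := by
  simp [pairMean, rad_zero]

omit hf hε in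
theorem regMean_zero : regMean p ε f (0 : ℝ) = (‖f 0‖ ^ 2 + ε) ^ (p / 2) := by
  simp [regMean]

omit [IsProbabilityMeasure (sigma d)] hf in
theorem laplMean_nonneg (hp : 2 ≤ p) (l : ℂ) : 0 ≤ laplMean p ε f l :=
  integral_nonneg fun _ => lapl_nonneg hp hε _ _

/-- `pairMean` vanishes at `0` and has derivative `laplMean / t ≥ 0`. Up to the factor `p / t` it is
the derivative of `regMean`, whose monotonicity follows. -/
theorem pairMean_nonneg (hp : 2 ≤ p) {t : ℝ} (ht : t ∈ Ico (0 : ℝ) 1) :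
    0 ≤ pairMean p ε f 1 t := by
  have hmono : MonotoneOn (fun t : ℝ => pairMean p ε f 1 t) (Ico 0 1) := by
    refine monotoneOn_of_deriv_nonneg (convex_Ico 0 1)
      ((continuousOn_pairMean hf hε).mono fun t => norm_ofReal_lt_one) ?_ ?_
    · rw [interior_Ico]
      exact fun t ht =>
        (hasDerivAt_pairMean_ofReal hf hε ht).differentiableAt.differentiableWithinAt
    · rw [interior_Ico]
      intro t ht
      rw [(hasDerivAt_pairMean_ofReal hf hε ht).deriv]
      exact div_nonneg (laplMean_nonneg hε hp _) ht.1.le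
  have h := hmono (left_mem_Ico.2 one_pos) ht ht.1
  rwa [← pairMean_zero (p := p) (ε := ε) (f := f)]

theorem monotoneOn_regMean (hp : 2 ≤ p) :
    MonotoneOn (fun t : ℝ => regMean p ε f t) (Ico 0 1) := by
  refine monotoneOn_of_deriv_nonneg (convex_Ico 0 1)
    ((continuousOn_regMean hf hε).mono fun t => norm_ofReal_lt_one) ?_ ?_
  · rw [interior_Ico]
    exact fun t ht =>
      (hasDerivAt_regMean_ofReal hf hε ht).differentiableAt.differentiableWithinAt
  · rw [interior_Ico]
    intro t ht
    rw [(hasDerivAt_regMean_ofReal hf hε ht).deriv]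
    exact div_nonneg (mul_nonneg (by linarith)
      (pairMean_nonneg hf hε hp (Ioo_subset_Ico_self ht))) ht.1.le

/-- The Hardy–Stein formula on an interval. -/
theorem regMean_eq_add_integral {a r : ℝ} (ha : 0 < a) (har : a ≤ r) (hr : r < 1) :
    regMean p ε f r = regMean p ε f a + (Real.log r - Real.log a) * (p * pairMean p ε f 1 a) +
      ∫ t in a..r, (Real.log r - Real.log t) * (p * (laplMean p ε f t / t)) := by
  have hsub : ∀ t ∈ uIcc a r, t ∈ Ioo (0 : ℝ) 1 := by
    rw [uIcc_of_le har]
    exact fun t ht => ⟨ha.trans_le ht.1, ht.2.trans_lt hr⟩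
  -- Two integrations at once: in the derivative of this antiderivative the two terms `± p *
  -- pairMean / t` cancel.
  have h := intervalIntegral.integral_eq_sub_of_hasDerivAt (a := a) (b := r)
    (f := fun t : ℝ => regMean p ε f t +
      (Real.log r - Real.log t) * (p * pairMean p ε f 1 t))
    (f' := fun t : ℝ => (Real.log r - Real.log t) * (p * (laplMean p ε f t / t))) ?_ ?_
  · rw [h]
    ring
  · intro t ht
    have h1 := hasDerivAt_regMean_ofReal (p := p) hf hε (hsub t ht)
    have h2 := (hasDerivAt_pairMean_ofReal (p := p) hf hε (hsub t ht)).const_mul p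
    have h3 := (Real.hasDerivAt_log (hsub t ht).1.ne').const_sub (Real.log r)
    refine (h1.add (h3.mul h2)).congr_deriv ?_
    ring
  · apply ContinuousOn.intervalIntegrable
    have h1 : ContinuousOn (fun t : ℝ => laplMean p ε f t) (uIcc a r) :=
      (continuousOn_laplMean hf hε).mono fun t ht =>
        norm_ofReal_lt_one (Ioo_subset_Ico_self (hsub t ht))
    have h2 : ContinuousOn (fun t : ℝ => Real.log t) (uIcc a r) :=
      Real.continuousOn_log.mono fun t ht => (hsub t ht).1.ne'
    exact (continuousOn_const.sub h2).mul (continuousOn_const.mul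
      (h1.div continuousOn_id fun t ht => (hsub t ht).1.ne'))

/-- The Hardy–Stein formula on `[a, r]` as `a → 0`; the boundary term is `O(a |log a|)`. -/
theorem ofReal_regMean_le (hp : 2 ≤ p) {r : ℝ} (hr : r ∈ Ioo (0 : ℝ) 1) :
    ENNReal.ofReal (regMean p ε f r) ≤ ENNReal.ofReal (regMean p ε f (0 : ℝ)) +
      ∫⁻ t in Ioo 0 r, ENNReal.ofReal (Real.log (r / t) / t) *
        ENNReal.ofReal (p * laplMean p ε f t) := by
  set T := ∫⁻ t in Ioo 0 r, ENNReal.ofReal (Real.log (r / t) / t) *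
        ENNReal.ofReal (p * laplMean p ε f t)
  have hle : ∀ a ∈ Ioo 0 r, ENNReal.ofReal (regMean p ε f r) ≤ ENNReal.ofReal
      (regMean p ε f a + (Real.log r - Real.log a) * (p * pairMean p ε f 1 a)) + T := by
    intro a ha
    rw [regMean_eq_add_integral hf hε ha.1 ha.2.le hr.2]
    refine ENNReal.ofReal_add_le.trans ?_
    gcongr
    rw [intervalIntegral.integral_of_le ha.2.le, integral_Ioc_eq_integral_Ioo]
    refine (ENNReal.ofReal_le_ofReal (le_abs_self _)).trans ?_
    rw [← Real.enorm_eq_ofReal_abs]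
    refine (enorm_integral_le_lintegral_enorm _).trans ?_
    refine (lintegral_mono_ae ?_).trans (lintegral_mono_set (Ioo_subset_Ioo_left ha.1.le))
    refine (ae_restrict_mem measurableSet_Ioo).mono fun t ht => ?_
    have ht0 : 0 < t := ha.1.trans ht.1
    have hlog : 0 ≤ Real.log (r / t) := Real.log_nonneg ((one_le_div ht0).2 ht.2.le)
    have hL := laplMean_nonneg (f := f) hε hp t
    rw [← Real.log_div hr.1.ne' ht0.ne', Real.enorm_of_nonneg (by positivity),
      ← ENNReal.ofReal_mul (by positivity)]
    refine ENNReal.ofReal_le_ofReal (le_of_eq ?_)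
    ring
  have hlim : Tendsto (fun a : ℝ => regMean p ε f a +
      (Real.log r - Real.log a) * (p * pairMean p ε f 1 a)) (𝓝[>] 0)
      (𝓝 (regMean p ε f (0 : ℝ) + 0)) := by
    refine Tendsto.add ?_ ?_
    · exact (((continuousOn_regMean hf hε).continuousAt
        (isOpen_norm_ofReal_lt_one.mem_nhds (by simp))).tendsto).mono_left nhdsWithin_le_nhds
    · obtain ⟨C, hC0, hC⟩ := exists_abs_pairMean_le (p := p) hf hε hr.1 hr.2
      have h1 : Tendsto (fun a : ℝ => |Real.log r * a - Real.log a * a| * (p * C)) (𝓝[>] 0)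
          (𝓝 (|Real.log r * 0 - 0| * (p * C))) := by
        refine Tendsto.mul_const _ (Tendsto.abs (Tendsto.sub ?_ ?_))
        · exact tendsto_const_nhds.mul (tendsto_id.mono_left nhdsWithin_le_nhds)
        · simpa using tendsto_log_mul_rpow_nhdsGT_zero one_pos
      rw [mul_zero, sub_zero, abs_zero, zero_mul] at h1
      refine squeeze_zero_norm' ?_ h1
      filter_upwards [Ioo_mem_nhdsGT hr.1] with a ha
      rw [← sub_mul, abs_mul, norm_mul, norm_mul, Real.norm_eq_abs, Real.norm_eq_abs,
        Real.norm_eq_abs, abs_of_nonneg (by linarith : 0 ≤ p), abs_of_pos ha.1, mul_assoc]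
      refine mul_le_mul_of_nonneg_left ?_ (abs_nonneg _)
      have := hC a ha.1.le ha.2.le
      calc p * |pairMean p ε f 1 a| ≤ p * (C * a) := by gcongr
        _ = a * (p * C) := by ring
  rw [add_zero] at hlim
  refine ge_of_tendsto ((ENNReal.tendsto_ofReal hlim).add_const T) ?_
  filter_upwards [Ioo_mem_nhdsGT hr.1] with a ha using hle a ha

/-- Hölder's inequality with weights `1 - 2/p` and `2/p`, after `lapl_le`, which supplies the second
factor `p`. -/
theorem ofReal_laplMean_le (hp : 2 ≤ p) {t : ℝ} (ht : t ∈ Ico (0 : ℝ) 1) :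
    ENNReal.ofReal (p * laplMean p ε f t) ≤ ENNReal.ofReal (p ^ 2) *
      (ENNReal.ofReal (regMean p ε f t) ^ (1 - 2 / p) * mean p (rad f) t ^ 2) := by
  have hp0 : 0 < p := by linarith
  have ht' := norm_ofReal_lt_one ht
  have hX : Continuous fun q : ℂ × ℂ × ℂ => (‖q.1‖ ^ 2 + ε) ^ (p / 2 - 1) * ‖q.2.1‖ ^ 2 :=
    Continuous.mul (Continuous.rpow_const (by fun_prop) fun w => Or.inl (by positivity))
      (by fun_prop)
  have i0 := integrable_jet hf (Ψ := fun w _ _ => (‖w‖ ^ 2 + ε) ^ (p / 2))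
    (continuous_rpow_jet hε) ht'
  have i1 := integrable_jet hf (Ψ := fun w a _ => lapl p ε w a) (continuous_lapl_jet hε) ht'
  have i2 := integrable_jet hf
    (Ψ := fun w a _ => (‖w‖ ^ 2 + ε) ^ (p / 2 - 1) * ‖a‖ ^ 2) hX ht'
  have h1 : p * laplMean p ε f t ≤ p ^ 2 * ∫ ζ : Metric.sphere (0 : Cn d) 1,
      (‖f ((t : ℂ) • (ζ : Cn d))‖ ^ 2 + ε) ^ (p / 2 - 1) *
        ‖rad f ((t : ℂ) • (ζ : Cn d))‖ ^ 2 ∂(sigma d) := by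
    rw [pow_two, mul_assoc]
    gcongr
    rw [← integral_const_mul]
    exact integral_mono i1 (i2.const_mul p) fun ζ => lapl_le hp hε _ _
  refine (ENNReal.ofReal_le_ofReal h1).trans ?_
  rw [ENNReal.ofReal_mul (by positivity)]
  gcongr
  rw [ofReal_integral_eq_lintegral_ofReal i2 (.of_forall fun ζ => by positivity), regMean,
    ofReal_integral_eq_lintegral_ofReal i0 (.of_forall fun ζ => by positivity), mean,
    ← ENNReal.rpow_natCast, ← ENNReal.rpow_mul]
  have hq : 1 / p * ((2 : ℕ) : ℝ) = 2 / p := by push_cast; ring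
  rw [hq]
  have hm : AEMeasurable (fun ζ : Metric.sphere (0 : Cn d) 1 =>
      ENNReal.ofReal ‖rad f ((t : ℂ) • (ζ : Cn d))‖ ^ p) (sigma d) :=
    ((continuous_comp_smul_sphere (d := d) hf.sliceHol_rad.continuousOn
      ht').norm.measurable.ennreal_ofReal.pow_const p).aemeasurable
  refine le_trans (le_of_eq ?_) (ENNReal.lintegral_mul_norm_pow_le
    i0.aestronglyMeasurable.aemeasurable.ennreal_ofReal hm
    (sub_nonneg.2 ((div_le_one hp0).2 hp)) (by positivity : 0 ≤ 2 / p) (by ring))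
  refine lintegral_congr fun ζ => ?_
  rw [ENNReal.ofReal_mul (by positivity), ENNReal.ofReal_rpow_of_nonneg (by positivity)
    (sub_nonneg.2 ((div_le_one hp0).2 hp)), ← Real.rpow_mul (by positivity),
    ← ENNReal.rpow_mul, ENNReal.ofReal_pow (norm_nonneg _), mul_div_cancel₀ _ hp0.ne']
  congr 1
  · congr 2
    field_simp
  · exact (ENNReal.rpow_two _).symm

theorem rpow_regMean_le (hp : 2 ≤ p) {r : ℝ} (hr : r ∈ Ioo (0 : ℝ) 1) :
    ENNReal.ofReal (regMean p ε f r) ^ (2 / p) ≤ ENNReal.ofReal (‖f 0‖ ^ 2 + ε) +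
      ENNReal.ofReal (p ^ 2) * ∫⁻ t in Ioo 0 r, ENNReal.ofReal (Real.log (r / t) / t) *
        mean p (rad f) t ^ 2 := by
  have hp0 : 0 < p := by linarith
  have hq0 : 0 ≤ 1 - 2 / p := sub_nonneg.2 ((div_le_one hp0).2 hp)
  have hmono := monotoneOn_regMean (p := p) hf hε hp
  set G := ENNReal.ofReal (regMean p ε f r) with hG
  have h0r : ENNReal.ofReal (regMean p ε f (0 : ℝ)) ≤ G :=
    ENNReal.ofReal_le_ofReal (hmono (left_mem_Ico.2 one_pos) (Ioo_subset_Ico_self hr) hr.1.le)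
  have hG0 : G ≠ 0 := by
    refine fun h => absurd (h ▸ h0r) ?_
    rw [regMean_zero, nonpos_iff_eq_zero, ENNReal.ofReal_eq_zero, not_le]
    positivity
  have hGt : G ≠ ∞ := ENNReal.ofReal_ne_top
  have hGq0 : G ^ (1 - 2 / p) ≠ 0 := by simp [hG0, hGt]
  have hGqt : G ^ (1 - 2 / p) ≠ ∞ := ENNReal.rpow_ne_top_of_nonneg hq0 hGt
  -- The claim is multiplied by `G ^ (1 - 2 / p)`, which may be cancelled since `ε > 0` keeps `G`
  -- positive. On the right, `G` dominates the values of `regMean` at `0` and at `t < r`.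
  rw [← ENNReal.mul_le_mul_iff_right hGq0 hGqt, ← ENNReal.rpow_add _ _ hG0 hGt,
    sub_add_cancel, ENNReal.rpow_one, mul_add]
  refine (ofReal_regMean_le hf hε hp hr).trans (add_le_add ?_ ?_)
  · have hx : 0 ≤ ‖f 0‖ ^ 2 + ε := by positivity
    calc ENNReal.ofReal (regMean p ε f (0 : ℝ))
        = ENNReal.ofReal (regMean p ε f (0 : ℝ)) ^ (1 - 2 / p) *
            ENNReal.ofReal (‖f 0‖ ^ 2 + ε) := by
          rw [regMean_zero, ENNReal.ofReal_rpow_of_nonneg (by positivity) hq0,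
            ← ENNReal.ofReal_mul (by positivity), ← Real.rpow_mul hx]
          congr 1
          rw [← Real.rpow_add_one (by positivity)]
          congr 1
          field_simp
          ring
      _ ≤ _ := by gcongr
  · rw [← mul_assoc, ← lintegral_const_mul' _ _ (ENNReal.mul_ne_top hGqt ENNReal.ofReal_ne_top)]
    refine setLIntegral_mono' measurableSet_Ioo fun t ht => ?_
    have ht' : t ∈ Ico (0 : ℝ) 1 := ⟨ht.1.le, ht.2.trans hr.2⟩
    refine (mul_le_mul_right (ofReal_laplMean_le hf hε hp ht') _).trans ?_
    have : ENNReal.ofReal (regMean p ε f t) ≤ G :=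
      ENNReal.ofReal_le_ofReal (hmono ht' (Ioo_subset_Ico_self hr) ht.2.le)
    calc _ ≤ ENNReal.ofReal (Real.log (r / t) / t) * (ENNReal.ofReal (p ^ 2) *
            (G ^ (1 - 2 / p) * mean p (rad f) t ^ 2)) := by gcongr
      _ = _ := by ring

end

/-- A Littlewood–Paley type inequality for the integral means. -/
theorem mean_sq_le [IsProbabilityMeasure (sigma d)] (hf : SliceHol f) (hp : 2 ≤ p) {r : ℝ}
    (hr : r ∈ Ioo (0 : ℝ) 1) :
    mean p f r ^ 2 ≤ ENNReal.ofReal ‖f 0‖ ^ 2 +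
      ENNReal.ofReal (p ^ 2) * ∫⁻ t in Ioo 0 r, ENNReal.ofReal (Real.log (r / t) / t) *
        mean p (rad f) t ^ 2 := by
  have hp0 : 0 < p := by linarith
  set T := ENNReal.ofReal (p ^ 2) * ∫⁻ t in Ioo 0 r, ENNReal.ofReal (Real.log (r / t) / t) *
        mean p (rad f) t ^ 2
  have hlim : Tendsto (fun ε : ℝ => ENNReal.ofReal (‖f 0‖ ^ 2 + ε) + T) (𝓝[>] 0)
      (𝓝 (ENNReal.ofReal (‖f 0‖ ^ 2 + 0) + T)) :=
    (ENNReal.tendsto_ofReal (tendsto_const_nhds.add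
      (tendsto_id.mono_left nhdsWithin_le_nhds))).add_const T
  rw [add_zero, ENNReal.ofReal_pow (norm_nonneg _)] at hlim
  refine ge_of_tendsto hlim ?_
  filter_upwards [self_mem_nhdsWithin] with ε hε
  rw [mem_Ioi] at hε
  refine le_trans ?_ (rpow_regMean_le hf hε hp hr)
  have i0 := integrable_jet hf (Ψ := fun w _ _ => (‖w‖ ^ 2 + ε) ^ (p / 2))
    (continuous_rpow_jet hε) (norm_ofReal_lt_one (Ioo_subset_Ico_self hr))
  rw [mean, ← ENNReal.rpow_natCast, ← ENNReal.rpow_mul, regMean,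
    ofReal_integral_eq_lintegral_ofReal i0 (.of_forall fun ζ => by positivity)]
  have hq : 1 / p * ((2 : ℕ) : ℝ) = 2 / p := by push_cast; ring
  rw [hq]
  refine ENNReal.rpow_le_rpow (lintegral_mono fun ζ => ?_) (by positivity)
  dsimp only
  rw [ENNReal.ofReal_rpow_of_nonneg (norm_nonneg _) hp0.le]
  refine ENNReal.ofReal_le_ofReal ?_
  calc ‖f ((r : ℂ) • (ζ : Cn d))‖ ^ p = (‖f ((r : ℂ) • (ζ : Cn d))‖ ^ 2) ^ (p / 2) := by
        rw [← Real.rpow_natCast, ← Real.rpow_mul (norm_nonneg _)]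
        congr 1
        push_cast
        ring
    _ ≤ _ := by
        gcongr
        linarith

end LittlewoodPaley

/-! ### A Schwarz lemma for integral means -/

/-- The normalized Lebesgue measure on `(0, 2π]`. -/
def angle : Measure ℝ :=
  (ENNReal.ofReal (2 * Real.pi))⁻¹ • volume.restrict (Ioc 0 (2 * Real.pi))

instance isProbabilityMeasure_angle : IsProbabilityMeasure angle := by
  refine ⟨?_⟩
  rw [angle, Measure.smul_apply, Measure.restrict_apply_univ, Real.volume_Ioc, sub_zero,
    smul_eq_mul]
  exact ENNReal.inv_mul_cancel (by simp [Real.pi_pos]) ENNReal.ofReal_ne_top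

theorem circleAverage_eq_integral_angle (g : ℂ → ℂ) (R : ℝ) :
    Real.circleAverage g 0 R = ∫ θ, g (circleMap 0 R θ) ∂angle := by
  rw [Real.circleAverage, intervalIntegral.integral_of_le Real.two_pi_pos.le, angle,
    integral_smul_measure, ENNReal.toReal_inv, ENNReal.toReal_ofReal Real.two_pi_pos.le]

theorem enorm_integral_rpow_le {α : Type*} [MeasurableSpace α] {μ : Measure α}
    [IsProbabilityMeasure μ] {p : ℝ} (hp : 1 ≤ p) {g : α → ℂ} (hg : AEStronglyMeasurable g μ) :
    ‖∫ x, g x ∂μ‖ₑ ^ p ≤ ∫⁻ x, ‖g x‖ₑ ^ p ∂μ := by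
  have hp0 : 0 < p := by linarith
  have h := eLpNorm'_le_eLpNorm'_of_exponent_le one_pos hp μ hg
  simp only [eLpNorm'_eq_lintegral_enorm, ENNReal.rpow_one, div_one] at h
  have h2 := (enorm_integral_le_lintegral_enorm g).trans h
  refine (ENNReal.rpow_le_rpow h2 hp0.le).trans_eq ?_
  rw [← ENNReal.rpow_mul, one_div_mul_cancel hp0.ne', ENNReal.rpow_one]

/-- A quantitative Schwarz lemma in terms of averages over a circle. -/
theorem enorm_rpow_le_lintegral_angle {F : ℂ → ℂ} (hF : DifferentiableOn ℂ F (Metric.ball 0 1))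
    (hF0 : F 0 = 0) {p : ℝ} (hp : 1 ≤ p) {t : ℝ} (ht0 : 0 < t) (ht : t ≤ 1 / 4) :
    ‖F t‖ₑ ^ p ≤ ENNReal.ofReal (4 * t) ^ p *
      ∫⁻ θ, ‖F (circleMap 0 (1 / 2) θ)‖ₑ ^ p ∂angle := by
  have hp0 : 0 ≤ p := by linarith
  set g := dslope F 0
  have hg : DifferentiableOn ℂ g (Metric.ball 0 1) :=
    (Complex.differentiableOn_dslope (Metric.ball_mem_nhds 0 one_pos)).2 hF
  have hsub : Metric.closedBall (0 : ℂ) (1 / 2) ⊆ Metric.ball 0 1 :=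
    Metric.closedBall_subset_ball (by norm_num)
  have hgc : DiffContOnCl ℂ g (Metric.ball 0 |1 / 2|) := by
    rw [abs_of_pos (by norm_num : (0 : ℝ) < 1 / 2)]
    refine DifferentiableOn.diffContOnCl ?_
    rw [closure_ball _ (by norm_num)]
    exact hg.mono hsub
  have hw : (t : ℂ) ∈ Metric.ball (0 : ℂ) |1 / 2| := by
    rw [mem_ball_zero_iff, Complex.norm_real, Real.norm_of_nonneg ht0.le,
      abs_of_pos (by norm_num : (0 : ℝ) < 1 / 2)]
    linarith
  -- Cauchy's formula for `g = F(z)/z`: its value at `t` is the average of `z g(z) / (z - t) = F(z)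
  -- / (z - t)` over `|z| = 1/2`. Since `|z - t| ≥ 1/4` there, the constant is `4`.
  have havg := hgc.circleAverage_smul_div hw
  rw [circleAverage_eq_integral_angle] at havg
  have hgF : ∀ z : ℂ, z ≠ 0 → F z = z * g z := by
    intro z hz
    rw [show g z = slope F 0 z from dslope_of_ne F hz, slope_def_field, hF0]
    field_simp
    ring
  have hcm : ∀ θ, ‖circleMap 0 (1 / 2) θ‖ = 1 / 2 := fun θ => by simp
  have hne : ∀ θ, circleMap 0 (1 / 2) θ - t ≠ 0 := fun θ h => by
    have h1 := hcm θ
    rw [sub_eq_zero.1 h, Complex.norm_real, Real.norm_of_nonneg ht0.le] at h1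
    linarith
  have hcont : Continuous fun θ : ℝ =>
      ((circleMap 0 (1 / 2) θ - 0) / (circleMap 0 (1 / 2) θ - t)) •
        g (circleMap 0 (1 / 2) θ) := by
    have h1 : Continuous fun θ : ℝ => circleMap 0 (1 / 2) θ := continuous_circleMap _ _
    refine ((h1.sub continuous_const).div (h1.sub continuous_const) hne).smul
      (hg.continuousOn.comp_continuous h1 fun θ => hsub ?_)
    rw [mem_closedBall_zero_iff, hcm]
  have hpt : ∀ θ : ℝ, ‖((circleMap 0 (1 / 2) θ - 0) / (circleMap 0 (1 / 2) θ - t)) •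
        g (circleMap 0 (1 / 2) θ)‖ ≤ 4 * ‖F (circleMap 0 (1 / 2) θ)‖ := by
    intro θ
    have hz0 : circleMap 0 (1 / 2) θ ≠ 0 := fun h => by
      have := hcm θ
      rw [h, norm_zero] at this
      norm_num at this
    have hlow : 1 / 4 ≤ ‖circleMap 0 (1 / 2) θ - t‖ := by
      have := norm_sub_norm_le (circleMap 0 (1 / 2) θ) t
      rw [hcm, Complex.norm_real, Real.norm_of_nonneg ht0.le] at this
      linarith
    rw [smul_eq_mul, sub_zero, div_mul_eq_mul_div, ← hgF _ hz0, norm_div,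
      div_le_iff₀ (by linarith)]
    nlinarith [norm_nonneg (F (circleMap 0 (1 / 2) θ))]
  rw [hgF t (by exact_mod_cast ht0.ne'), enorm_mul, ← havg,
    ENNReal.mul_rpow_of_nonneg _ _ hp0]
  calc _ ≤ ‖(t : ℂ)‖ₑ ^ p * ∫⁻ θ, (4 * ‖F (circleMap 0 (1 / 2) θ)‖ₑ) ^ p ∂angle := by
        gcongr
        refine (enorm_integral_rpow_le hp hcont.aestronglyMeasurable).trans ?_
        refine lintegral_mono fun θ => ENNReal.rpow_le_rpow ?_ hp0
        have h4 : (4 : ℝ≥0∞) = ENNReal.ofReal 4 := by norm_num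
        rw [← ofReal_norm, ← ofReal_norm, h4,
          ← ENNReal.ofReal_mul (by norm_num)]
        exact ENNReal.ofReal_le_ofReal (hpt θ)
    _ = _ := by
        simp_rw [ENNReal.mul_rpow_of_nonneg _ _ hp0]
        rw [lintegral_const_mul' _ _ (by simp), ← mul_assoc,
          ← ENNReal.mul_rpow_of_nonneg _ _ hp0]
        congr 2
        rw [ENNReal.ofReal_mul (by norm_num), mul_comm, ← ofReal_norm, Complex.norm_real,
          Real.norm_of_nonneg ht0.le]
        norm_num

/-- The one-variable estimate on each slice is integrated over the sphere; after Fubini, rotation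
invariance makes the inner integral independent of the angle. -/
theorem mean_le_of_map_zero {d : ℕ} [IsProbabilityMeasure (sigma d)] {F : Cn d → ℂ}
    (hF : SliceHol F) (hF0 : F 0 = 0) {p : ℝ} (hp : 1 ≤ p) {t : ℝ} (ht0 : 0 < t)
    (ht : t ≤ 1 / 4) : mean p F t ≤ ENNReal.ofReal (4 * t) * mean p F (1 / 2) := by
  have hp0 : 0 < p := by linarith
  have hpt : ∀ ζ : Metric.sphere (0 : Cn d) 1, ENNReal.ofReal ‖F ((t : ℂ) • (ζ : Cn d))‖ ^ p ≤
      ENNReal.ofReal (4 * t) ^ p * ∫⁻ θ, ENNReal.ofReal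
        ‖F (((1 / 2 : ℝ) : ℂ) • (rotate (Circle.exp θ) ζ : Cn d))‖ ^ p ∂angle := by
    intro ζ
    have h := enorm_rpow_le_lintegral_angle (F := fun l : ℂ => F (l • (ζ : Cn d)))
      ((hF.slice ζ).mono fun l hl => ?_) (by simpa using hF0) hp ht0 ht
    · simp only [← ofReal_norm] at h
      refine h.trans_eq ?_
      congr 1
      refine lintegral_congr fun θ => ?_
      have : circleMap 0 (1 / 2) θ • (ζ : Cn d) =
          ((1 / 2 : ℝ) : ℂ) • (rotate (Circle.exp θ) ζ : Cn d) := by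
        rw [circleMap, zero_add, mul_smul]
        rfl
      rw [this]
    · rw [mem_ofPred_eq, norm_smul_sphere]
      simpa using hl
  have hmeas : Measurable fun q : Metric.sphere (0 : Cn d) 1 × ℝ => ENNReal.ofReal
        ‖F (((1 / 2 : ℝ) : ℂ) • (rotate (Circle.exp q.2) q.1 : Cn d))‖ ^ p := by
    have hc : Continuous fun q : Metric.sphere (0 : Cn d) 1 × ℝ =>
        F (((1 / 2 : ℝ) : ℂ) • (rotate (Circle.exp q.2) q.1 : Cn d)) := by
      refine hF.continuousOn.comp_continuous ?_ fun q => ?_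
      · have : Continuous fun q : Metric.sphere (0 : Cn d) 1 × ℝ =>
            ((1 / 2 : ℝ) : ℂ) • ((Circle.exp q.2 : Circle) : ℂ) • (q.1 : Cn d) := by fun_prop
        exact this
      · rw [mem_ball_zero_iff, norm_smul_sphere]
        norm_num
    exact hc.norm.measurable.ennreal_ofReal.pow_const p
  calc mean p F t ≤ (ENNReal.ofReal (4 * t) ^ p * mean p F (1 / 2) ^ p) ^ (1 / p) := by
        refine ENNReal.rpow_le_rpow ((lintegral_mono hpt).trans ?_) (by positivity)
        rw [lintegral_const_mul' _ _
          (ENNReal.rpow_ne_top_of_nonneg hp0.le ENNReal.ofReal_ne_top)]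
        gcongr
        rw [lintegral_lintegral_swap hmeas.aemeasurable, mean, ← ENNReal.rpow_mul,
          one_div_mul_cancel hp0.ne', ENNReal.rpow_one]
        refine le_of_eq ?_
        have hrot (θ : ℝ) := lintegral_rotate (Circle.exp θ) fun ζ : Metric.sphere (0 : Cn d) 1 =>
          ENNReal.ofReal ‖F (((1 / 2 : ℝ) : ℂ) • (ζ : Cn d))‖ ^ p
        simp only [hrot, lintegral_const, measure_univ, mul_one]
    _ = _ := by
        rw [← ENNReal.mul_rpow_of_nonneg _ _ hp0.le, ← ENNReal.rpow_mul,
          mul_one_div_cancel hp0.ne', ENNReal.rpow_one]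

/-! ### Inserting the gauge function -/

theorem mean_congr {d : ℕ} {f g : Cn d → ℂ} {r : ℝ} (hr : r ∈ Ioo (0 : ℝ) 1)
    (h : ∀ z : Cn d, ‖z‖ < 1 → f z = g z) (p : ℝ) : mean p f r = mean p g r := by
  unfold mean
  congr 1
  refine lintegral_congr fun ζ => ?_
  rw [h _ (by rw [norm_smul_sphere]; exact norm_ofReal_lt_one (Ioo_subset_Ico_self hr))]

theorem mean_radial_le {d : ℕ} {ω : ℝ → ℝ} (hω : IsGauge ω) {p : ℝ} (f : Cn d → ℂ) {r : ℝ}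
    (hr : r ∈ Ioo (0 : ℝ) 1) :
    mean p (radial f) r ≤ hbNorm ω p f * ENNReal.ofReal (ω (1 - r) / (1 - r)) := by
  have h1 : 0 < 1 - r := by linarith [hr.2]
  have hw : 0 < ω (1 - r) := hω _ ⟨h1, by linarith [hr.1]⟩
  have h : mean p (radial f) r * ENNReal.ofReal (1 - r) / ENNReal.ofReal (ω (1 - r)) ≤
      hbNorm ω p f :=
    (le_iSup₂ (f := fun r (_ : r ∈ Ioo (0 : ℝ) 1) => mean p (radial f) r *
      ENNReal.ofReal (1 - r) / ENNReal.ofReal (ω (1 - r))) r hr).trans le_add_self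
  rw [ENNReal.div_le_iff (by simpa using hw) ENNReal.ofReal_ne_top] at h
  rw [ENNReal.ofReal_div_of_pos h1, ← mul_div_assoc,
    ENNReal.le_div_iff_mul_le (Or.inl (by simpa using h1)) (Or.inl ENNReal.ofReal_ne_top)]
  exact h

/-- The integral in the Littlewood–Paley inequality is controlled by the gauge function. -/
theorem lintegral_mean_radial_sq_le {d : ℕ} [IsProbabilityMeasure (sigma d)] {ω : ℝ → ℝ}
    (hω : IsGauge ω) {p : ℝ} (hp : 1 ≤ p) {f : Cn d → ℂ} (hf : IsHol f) (hN : hbNorm ω p f ≠ ∞)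
    {r : ℝ} (hr : r ∈ Ioo (0 : ℝ) 1) :
    ∫⁻ t in Ioo 0 r, ENNReal.ofReal (Real.log (r / t) / t) * mean p (rad f) t ^ 2 ≤
      hbNorm ω p f ^ 2 * (16 * (ENNReal.ofReal (r * ω (1 / 2) ^ 2) +
        ∫⁻ t in Ioo (1 - r) 1, ENNReal.ofReal (ω t ^ 2 / t))) := by
  set N := hbNorm ω p f
  have hN2 : N ^ 2 ≠ ∞ := ENNReal.pow_ne_top hN
  have hrad : ∀ t ∈ Ioo (0 : ℝ) 1, mean p (rad f) t ≤ N * ENNReal.ofReal (ω (1 - t) / (1 - t)) := by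
    intro t ht
    rw [← mean_congr ht (fun z hz => hf.radial_eq_rad hz)]
    exact mean_radial_le hω f ht
  have hw0 : 0 < ω (1 / 2) := hω _ (by norm_num)
  have hlogle : ∀ t ∈ Ioo 0 r, Real.log (r / t) ≤ (r - t) / t := by
    intro t ht
    have := Real.log_le_sub_one_of_pos (div_pos hr.1 ht.1)
    rwa [div_sub_one ht.1.ne'] at this
  have hlog0 : ∀ t ∈ Ioo 0 r, 0 ≤ Real.log (r / t) / t := fun t ht =>
    div_nonneg (Real.log_nonneg ((one_le_div ht.1).2 ht.2.le)) ht.1.le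
  -- Here `M_p(Rf,t) ≤ 4t · M_p(Rf,1/2) ≤ 8t ω(1/2) N`. The square `64 t²` absorbs the singular
  -- kernel, and the length `1/4` turns `64` into `16`. Keeping the factor `r` is essential for a
  -- constant uniform in increasing `ω`.
  have hsmall : ∫⁻ t in Ioo 0 r ∩ Iio (1 / 4), ENNReal.ofReal (Real.log (r / t) / t) *
      mean p (rad f) t ^ 2 ≤ N ^ 2 * (16 * ENNReal.ofReal (r * ω (1 / 2) ^ 2)) := by
    calc _ ≤ ∫⁻ t in Ioo 0 r ∩ Iio (1 / 4), N ^ 2 * ENNReal.ofReal (64 * r * ω (1 / 2) ^ 2) := by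
          refine setLIntegral_mono' (measurableSet_Ioo.inter measurableSet_Iio) fun t ht => ?_
          obtain ⟨ht1, ht2⟩ := ht
          rw [mem_Iio] at ht2
          have h1 := mean_le_of_map_zero hf.sliceHol.sliceHol_rad (rad_zero f) hp ht1.1 ht2.le
          have h2 := hrad (1 / 2) (by norm_num)
          have h3 : mean p (rad f) t ≤ N * ENNReal.ofReal (8 * t * ω (1 / 2)) := by
            refine h1.trans ((mul_le_mul_right h2 _).trans_eq ?_)
            rw [mul_left_comm, ← ENNReal.ofReal_mul (by linarith [ht1.1])]
            congr 2
            norm_num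
            ring
          calc _ ≤ ENNReal.ofReal (Real.log (r / t) / t) *
                (N * ENNReal.ofReal (8 * t * ω (1 / 2))) ^ 2 := by gcongr
            _ = N ^ 2 * ENNReal.ofReal (Real.log (r / t) / t * (8 * t * ω (1 / 2)) ^ 2) := by
                rw [mul_pow, ← ENNReal.ofReal_pow (by have := ht1.1; positivity), mul_left_comm,
                  ← ENNReal.ofReal_mul (hlog0 t ht1)]
            _ ≤ _ := by
                gcongr N ^ 2 * ENNReal.ofReal ?_
                have ht0 := ht1.1
                calc Real.log (r / t) / t * (8 * t * ω (1 / 2)) ^ 2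
                    ≤ (r - t) / t / t * (8 * t * ω (1 / 2)) ^ 2 := by
                      gcongr
                      exact hlogle t ht1
                  _ = 64 * (r - t) * ω (1 / 2) ^ 2 := by
                      field_simp
                      ring
                  _ ≤ _ := by
                      gcongr
                      linarith
      _ ≤ ∫⁻ t in Ioo 0 (1 / 4), N ^ 2 * ENNReal.ofReal (64 * r * ω (1 / 2) ^ 2) :=
          lintegral_mono_set fun t ht => ⟨ht.1.1, ht.2⟩
      _ = _ := by
          rw [setLIntegral_const, Real.volume_Ioo, mul_assoc,
            ← ENNReal.ofReal_mul (by have := hr.1; positivity),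
            show (16 : ℝ≥0∞) = ENNReal.ofReal 16 by norm_num,
            ← ENNReal.ofReal_mul (by norm_num)]
          congr 2
          ring
  have hlarge : ∫⁻ t in Ioo 0 r \ Iio (1 / 4), ENNReal.ofReal (Real.log (r / t) / t) *
      mean p (rad f) t ^ 2 ≤
        N ^ 2 * (16 * ∫⁻ t in Ioo (1 - r) 1, ENNReal.ofReal (ω t ^ 2 / t)) := by
    -- As `ω` may be nonmeasurable, the substitution uses a measurable embedding, and constants are
    -- later moved through the integral by their finiteness.
    have hcv : ∫⁻ t in Ioo (1 - r) 1, ENNReal.ofReal (ω t ^ 2 / t) =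
        ∫⁻ t in Ioo 0 r, ENNReal.ofReal (ω (1 - t) ^ 2 / (1 - t)) := by
      have hmp : MeasurePreserving (fun t : ℝ => 1 - t) volume volume :=
        Measure.measurePreserving_sub_left volume 1
      have hemb : MeasurableEmbedding (fun t : ℝ => 1 - t) :=
        (Homeomorph.subLeft (1 : ℝ)).measurableEmbedding
      rw [← hmp.setLIntegral_comp_preimage_emb hemb]
      congr 2
      ext t
      simp only [mem_preimage, mem_Ioo]
      constructor <;> rintro ⟨h1, h2⟩ <;> constructor <;> linarith
    rw [hcv, ← lintegral_const_mul' _ _ (by norm_num), ← lintegral_const_mul' _ _ hN2]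
    refine (setLIntegral_mono' (measurableSet_Ioo.diff measurableSet_Iio) fun t ht => ?_).trans
      (lintegral_mono_set sdiff_subset)
    obtain ⟨ht1, ht2⟩ := ht
    rw [mem_Iio, not_lt] at ht2
    have h1t : 0 < 1 - t := by linarith [ht1.2, hr.2]
    have hw : 0 < ω (1 - t) := hω _ ⟨h1t, by linarith [ht1.1]⟩
    have h3 := hrad t ⟨ht1.1, by linarith⟩
    calc _ ≤ ENNReal.ofReal (Real.log (r / t) / t) *
          (N * ENNReal.ofReal (ω (1 - t) / (1 - t))) ^ 2 := by gcongr
      _ = N ^ 2 * ENNReal.ofReal (Real.log (r / t) / t * (ω (1 - t) / (1 - t)) ^ 2) := by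
          rw [mul_pow, ← ENNReal.ofReal_pow (by positivity), mul_left_comm,
            ← ENNReal.ofReal_mul (hlog0 t ht1)]
      _ ≤ _ := by
          rw [show (16 : ℝ≥0∞) = ENNReal.ofReal 16 by norm_num,
            ← ENNReal.ofReal_mul (by norm_num)]
          gcongr N ^ 2 * ENNReal.ofReal ?_
          have ht0 := ht1.1
          -- `log(r/t)/t ≤ (r - t)/t²`, and `t ≥ 1/4` with `r < 1`.
          have hk : Real.log (r / t) / t ≤ 16 * (1 - t) := by
            rw [div_le_iff₀ ht0]
            refine (hlogle t ht1).trans ?_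
            rw [div_le_iff₀ ht0]
            have h16 : 1 ≤ 16 * t * t := by nlinarith
            nlinarith [mul_nonneg h1t.le (sub_nonneg.2 h16), hr.2]
          calc Real.log (r / t) / t * (ω (1 - t) / (1 - t)) ^ 2
              ≤ 16 * (1 - t) * (ω (1 - t) / (1 - t)) ^ 2 := by gcongr
            _ = _ := by field_simp
  rw [← lintegral_inter_add_sdiff _ (Ioo 0 r) measurableSet_Iio, mul_add, mul_add]
  exact add_le_add hsmall hlarge

/-- The parameter `M` isolates the only possible dependence of the constant on `ω`, so that both
claims become instances. -/
theorem mean_le_of_le_Phi {d : ℕ} [IsProbabilityMeasure (sigma d)] {ω : ℝ → ℝ}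
    (hω : IsGauge ω) {p : ℝ} (hp : 2 ≤ p) {f : Cn d → ℂ} (hf : MemHB ω p f)
    {r : ℝ} (hr : r ∈ Ioo (0 : ℝ) 1) {M : ℝ} (hM : 0 ≤ M)
    (h : ENNReal.ofReal (r * ω (1 / 2) ^ 2) ≤ ENNReal.ofReal M * Phi ω (1 - r)) :
    mean p f r ≤ (Real.sqrt (1 + p ^ 2 * (16 * (M + 1)))).toNNReal * hbNorm ω p f *
      Phi ω (1 - r) ^ (1 / 2 : ℝ) := by
  set N := hbNorm ω p f
  set P := Phi ω (1 - r) with hP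
  have hP1 : 1 ≤ P := le_self_add
  have hint : ∫⁻ t in Ioo (1 - r) 1, ENNReal.ofReal (ω t ^ 2 / t) ≤ P := le_add_self
  have h0 : ENNReal.ofReal ‖f 0‖ ≤ N := le_self_add
  have key : mean p f r ^ 2 ≤ ENNReal.ofReal (1 + p ^ 2 * (16 * (M + 1))) * N ^ 2 * P := by
    calc mean p f r ^ 2 ≤ _ := mean_sq_le hf.1.sliceHol hp hr
      _ ≤ N ^ 2 * P + ENNReal.ofReal (p ^ 2) *
          (N ^ 2 * (16 * (ENNReal.ofReal M * P + P))) := by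
          gcongr
          · calc ENNReal.ofReal ‖f 0‖ ^ 2 ≤ N ^ 2 * 1 := by rw [mul_one]; gcongr
              _ ≤ _ := by gcongr
          · refine (lintegral_mean_radial_sq_le hω (by linarith) hf.1 hf.2.ne hr).trans ?_
            gcongr
      _ = _ := by
          rw [ENNReal.ofReal_add one_pos.le (by positivity), ENNReal.ofReal_mul (by positivity),
            ENNReal.ofReal_mul (by norm_num), ENNReal.ofReal_add hM one_pos.le,
            ENNReal.ofReal_one, show ENNReal.ofReal 16 = 16 by norm_num]
          ring
  have h2 := ENNReal.rpow_le_rpow key (by norm_num : (0 : ℝ) ≤ 1 / 2)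
  rw [← ENNReal.rpow_two, ← ENNReal.rpow_mul, ENNReal.mul_rpow_of_nonneg _ _ (by norm_num),
    ENNReal.mul_rpow_of_nonneg _ _ (by norm_num), ← ENNReal.rpow_two, ← ENNReal.rpow_mul,
    ENNReal.ofReal_rpow_of_nonneg (by positivity) (by norm_num), ← Real.sqrt_eq_rpow] at h2
  norm_num at h2
  simpa [ENNReal.ofReal] using h2

/-- On `(1 - r/2, 1)`, an interval of length `r/2` inside `(1/2, 1)`, monotonicity gives `ω(t)²/t ≥
ω(1/2)²`; hence the factor `2`. -/
theorem ofReal_mul_sq_le_Phi {ω : ℝ → ℝ} (hω : IsGauge ω) (hmono : MonotoneOn ω (Ioc (0 : ℝ) 1))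
    {r : ℝ} (hr : r ∈ Ioo (0 : ℝ) 1) :
    ENNReal.ofReal (r * ω (1 / 2) ^ 2) ≤ ENNReal.ofReal 2 * Phi ω (1 - r) := by
  have hw : 0 < ω (1 / 2) := hω _ (by norm_num)
  have h1 : ENNReal.ofReal (r / 2 * ω (1 / 2) ^ 2) ≤ Phi ω (1 - r) := by
    calc ENNReal.ofReal (r / 2 * ω (1 / 2) ^ 2)
        = ∫⁻ t in Ioo (1 - r / 2) 1, ENNReal.ofReal (ω (1 / 2) ^ 2) := by
          rw [setLIntegral_const, Real.volume_Ioo, ← ENNReal.ofReal_mul (by positivity)]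
          congr 1
          ring
      _ ≤ ∫⁻ t in Ioo (1 - r / 2) 1, ENNReal.ofReal (ω t ^ 2 / t) := by
          refine setLIntegral_mono' measurableSet_Ioo fun t ht => ?_
          have ht2 : 1 / 2 ≤ t := by linarith [ht.1, hr.2]
          have hωt : ω (1 / 2) ≤ ω t :=
            hmono (by norm_num) ⟨by linarith, ht.2.le⟩ ht2
          refine ENNReal.ofReal_le_ofReal ?_
          rw [le_div_iff₀ (by linarith)]
          calc ω (1 / 2) ^ 2 * t ≤ ω (1 / 2) ^ 2 * 1 := by gcongr; exact ht.2.le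
            _ ≤ ω t ^ 2 := by rw [mul_one]; gcongr
      _ ≤ ∫⁻ t in Ioo (1 - r) 1, ENNReal.ofReal (ω t ^ 2 / t) :=
          lintegral_mono_set (Ioo_subset_Ioo_left (by linarith [hr.1]))
      _ ≤ _ := le_add_self
  calc ENNReal.ofReal (r * ω (1 / 2) ^ 2)
      = ENNReal.ofReal 2 * ENNReal.ofReal (r / 2 * ω (1 / 2) ^ 2) := by
        rw [← ENNReal.ofReal_mul (by norm_num)]
        congr 1
        ring
    _ ≤ _ := by gcongr

end HardyBloch

end

theorem mainTheorem4 (d : ℕ) (hd : 1 ≤ d) (p : ℝ) (hp : 2 ≤ p) :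
    (∀ ω : ℝ → ℝ, HardyBloch.IsGauge ω →
      ∃ C : ℝ≥0, 0 < C ∧ ∀ f : HardyBloch.Cn d → ℂ, HardyBloch.MemHB ω p f →
        ∀ r ∈ Ioo (0 : ℝ) 1,
          HardyBloch.mean p f r ≤
            C * HardyBloch.hbNorm ω p f * HardyBloch.Phi ω (1 - r) ^ (1 / 2 : ℝ)) ∧
    (∃ C : ℝ≥0, 0 < C ∧ ∀ ω : ℝ → ℝ, HardyBloch.IsGauge ω → MonotoneOn ω (Ioc (0 : ℝ) 1) →
      ∀ f : HardyBloch.Cn d → ℂ, HardyBloch.MemHB ω p f →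
        ∀ r ∈ Ioo (0 : ℝ) 1,
          HardyBloch.mean p f r ≤
            C * HardyBloch.hbNorm ω p f * HardyBloch.Phi ω (1 - r) ^ (1 / 2 : ℝ)) := by
  have := HardyBloch.isProbabilityMeasure_sigma hd
  -- Unification sets both constants to `√(1 + 16p²(M + 1))`, with `M = ω(1/2)²` for a general
  -- gauge, where `r ≤ 1 ≤ Φ` suffices, and `M = 2` for an increasing one.
  refine ⟨fun ω hω => ⟨_, ?_, fun f hf r hr => HardyBloch.mean_le_of_le_Phi hω hp hf hr
    (sq_nonneg (ω (1 / 2))) ?_⟩, ⟨_, ?_, fun ω hω hmono f hf r hr =>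
      HardyBloch.mean_le_of_le_Phi hω hp hf hr two_pos.le
        (HardyBloch.ofReal_mul_sq_le_Phi hω hmono hr)⟩⟩
  · rw [Real.toNNReal_pos]
    positivity
  · calc ENNReal.ofReal (r * ω (1 / 2) ^ 2) ≤ ENNReal.ofReal (ω (1 / 2) ^ 2) * 1 := by
          rw [mul_one]
          exact ENNReal.ofReal_le_ofReal (mul_le_of_le_one_left (sq_nonneg _) hr.2.le)
      _ ≤ _ := by
          gcongr
          exact le_self_add
  · rw [Real.toNNReal_pos]
    positivity
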